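/- Let $f(x)=f_0x^m+\dots+f_m$ and $g(x)=g_0x^n+\dots+g_n$ be complex polynomials with $f_0g_0\neq 0$ and $m<n<2m+1$, and consider the Liénard system $x_t=y$, $y_t=-f(x)y-g(x)$. A non-constant polynomial $F\in\mathbb{C}[x,y]$ is an invariant algebraic curve of it with cofactor $\lambda\in\mathbb{C}[x,y]$ if $$yF_x-\bigl(f(x)y+g(x)\bigr)F_y=\lambda F .$$ Consider also the equation $$y\,y_x+f(x)y+g(x)=0 \qquad (*)$$ for formal Laurent series $y(x)\in\mathbb{C}((x^{-1}))$ near $x=\infty$, and let $\{W\}_+$ denote the polynomial part of $W\in\mathbb{C}((x^{-1}))[y]$, i.e. the sum of its monomials $c\,x^iy^j$ with $i,j\ge 0$. Then the following hold. (a) There are polynomials $$q(x)=-\frac{f_0}{m+1}x^{m+1}+\sum_{l=1}^{m}q_{m+1-l}x^l,\qquad p(x)=-\frac{g_0}{f_0}x^{n-m}+\sum_{l=1}^{n-m-1}p_{n-m-l}x^l,$$ each of which is uniquely determined by $f$ and $g$: $q$ is the only polynomial of the first form with $\deg(qq_x+fq+g)\le m$, and $p$ is the only polynomial of the second form with $\deg(pp_x+fp+g)\le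 m$. (b) Every solution of $(*)$ with leading term $-\frac{f_0}{m+1}x^{m+1}$ (a series of type (I)) has the form $y=q(x)+\sum_{l\ge 0}c_{m+1+l}x^{-l}$, where each $c_{m+1+l}$, $l\ge 1$, is a polynomial in $c_{m+1}$ that depends only on $f$, $g$ and $l$. (Such solutions need not exist.) (c) There is exactly one solution of $(*)$ with leading term $-\frac{g_0}{f_0}x^{n-m}$ (the series of type (II)), and it has the form $y_{II}=p(x)+\sum_{l\ge 0}b_{l}x^{-l}$. (d) For every irreducible invariant algebraic curve $F\in\mathbb{C}[x,y]\setminus\mathbb{C}$ of the system, with cofactor $\lambda$, there are an integer $N\ge 1$, a number $k\in\{0,1\}$, a constant $\mu\in\mathbb{C}\setminus\{0\}$ and solutions $y_j(x)=q(x)+\sum_{l\ge 0}c^{(j)}_{m+1+l}x^{-l}$, $j=1,\dots,N-k$, of $(*)$ of type (I) with pairwise distinct coefficients $c^{(1)}_{m+1},\dots,c^{(N-k)}_{m+1}$, the other coefficients being given by the polynomials of (b), such that $$F(x,y)=\mu\Bigl\{\prod_{j=1}^{N-k}\bigl(y-y_j(x)\bigr)\cdot\bigl(y-y_{II}(x)\bigr)^{k}\Bigr\}_+,\qquad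 \lambda(x,y)=-Nf-(N-k)q_x-kp_x,$$ where the product over $j$ is $1$ if $N=k=1$. -/

import Mathlib

open Polynomial
open scoped Polynomial.Bivariate

noncomputable section

namespace Lienard

/-! ### Invariant algebraic curves of planar polynomial vector fields

The ring `ℂ[x, y]` is `ℂ[X][Y]`: the inner variable is `x`, the outer one is `y`. -/

/-- The partial derivative `∂F/∂x`, i.e. differentiation of the coefficients (which are polynomials
in `x`). The partial derivative `∂F/∂y` is `Polynomial.derivative F`. -/
def partialX (F : ℂ[X][Y]) : ℂ[X][Y] :=
  F.sum fun i a => monomial i (derivative a)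

theorem coeff_partialX (F : ℂ[X][Y]) (i : ℕ) :
    (partialX F).coeff i = derivative (F.coeff i) := by
  simp only [partialX, Polynomial.sum_def, finsetSum_coeff, coeff_monomial]
  rw [Finset.sum_ite_eq' F.support i]
  by_cases h : i ∈ F.support
  · simp [h]
  · simp [notMem_support_iff.mp h]

/-- `F` is a non-constant polynomial defining an invariant algebraic curve, with cofactor `L`, of
the vector field `P ∂/∂x + Q ∂/∂y`. -/
def IsInvariantCurve (P Q F L : ℂ[X][Y]) : Prop :=
  (∀ a : ℂ, F ≠ C (C a)) ∧ P * partialX F + Q * derivative F = L * F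

/-- `F` defines an invariant algebraic curve with cofactor `L` of the Liénard system
`x_t = y`, `y_t = -f(x) y - g(x)`. -/
def IsLienardInvariantCurve (f g : ℂ[X]) (F L : ℂ[X][Y]) : Prop :=
  IsInvariantCurve Y (-(C f * Y) - C g) F L

/-! ### Formal Laurent series at `x = ∞`

The field of formal Laurent series at `x = ∞` is `ℂ((t))` with `t = x⁻¹`. -/

/-- The coefficient of `x ^ i` in a Laurent series at infinity. -/
def coeffX (y : LaurentSeries ℂ) (i : ℤ) : ℂ := y.coeff (-i)

/-- The embedding of `ℂ[x]` in the field of Laurent series at infinity, `x ↦ t⁻¹`. -/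
def ofPoly : ℂ[X] →+* LaurentSeries ℂ :=
  Polynomial.eval₂RingHom HahnSeries.C (HahnSeries.single (-1 : ℤ) (1 : ℂ))

theorem coeffX_ofPoly (p : ℂ[X]) (i : ℕ) : coeffX (ofPoly p) i = p.coeff i := by
  rw [ofPoly, coeffX, coe_eval₂RingHom, eval₂_eq_sum_range, HahnSeries.coeff_sum]
  rw [Finset.sum_eq_single i]
  · simp
  · intro b _ hb
    have h : -(i : ℤ) ≠ -(b : ℤ) := by omega
    simp [HahnSeries.coeff_single_of_ne h]
  · intro h
    rw [Finset.mem_range] at h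
    simp [coeff_eq_zero_of_natDegree_lt (show p.natDegree < i by omega)]

/-- The series `∑_{l ≥ 0} c_l x^{-l}`. -/
def tail (c : ℕ → ℂ) : LaurentSeries ℂ :=
  HahnSeries.ofPowerSeries ℤ ℂ (PowerSeries.mk c)

/-- The derivation `d/dx = -t² d/dt`. -/
def derivX (y : LaurentSeries ℂ) : LaurentSeries ℂ :=
  -(HahnSeries.single (2 : ℤ) (1 : ℂ) * LaurentSeries.derivative ℂ y)

theorem coeffX_derivX (y : LaurentSeries ℂ) (i : ℤ) :
    coeffX (derivX y) (i - 1) = i * coeffX y i := by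
  have h : -(i - 1) = (-i - 1) + 2 := by ring
  rw [coeffX, derivX, coeffX, HahnSeries.coeff_neg, h,
    HahnSeries.coeff_single_mul_add, LaurentSeries.derivative_apply, LaurentSeries.hasseDeriv_coeff]
  simp

/-- `y` is a solution of `y y_x + f(x) y + g(x) = 0`. -/
def IsSolution (f g : ℂ[X]) (y : LaurentSeries ℂ) : Prop :=
  y * derivX y + ofPoly f * y + ofPoly g = 0

/-- The leading term of `y` at infinity is `a x ^ r`. -/
def HasLeadingTerm (y : LaurentSeries ℂ) (a : ℂ) (r : ℤ) : Prop :=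
  a ≠ 0 ∧ coeffX y r = a ∧ ∀ i : ℤ, r < i → coeffX y i = 0

/-- The polynomial part of a Laurent series at infinity. -/
def polyPartX (y : LaurentSeries ℂ) : ℂ[X] :=
  ∑ i ∈ Finset.range ((-y.order).toNat + 1), monomial i (coeffX y i)

theorem coeff_polyPartX (y : LaurentSeries ℂ) (i : ℕ) :
    (polyPartX y).coeff i = coeffX y i := by
  simp only [polyPartX, finsetSum_coeff, coeff_monomial]
  rw [Finset.sum_ite_eq' (Finset.range _) i]
  split_ifs with h
  · rfl
  · rw [coeffX, HahnSeries.coeff_eq_zero_of_lt_order]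
    rw [Finset.mem_range] at h
    omega

/-- The polynomial part `{W}_+` of a polynomial `W` in `y` whose coefficients are Laurent series at
infinity: the sum of the monomials `c x^i y^j` of `W` with `i ≥ 0` and `j ≥ 0`. -/
def polyPart (W : (LaurentSeries ℂ)[X]) : ℂ[X][Y] :=
  W.sum fun j a => monomial j (polyPartX a)

theorem coeff_polyPart (W : (LaurentSeries ℂ)[X]) (i j : ℕ) :
    ((polyPart W).coeff j).coeff i = coeffX (W.coeff j) i := by
  rw [polyPart, Polynomial.sum_def, finsetSum_coeff]
  simp only [coeff_monomial]
  rw [Finset.sum_ite_eq' W.support j]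
  by_cases h : j ∈ W.support
  · simp [h, coeff_polyPartX]
  · simp [notMem_support_iff.mp h, coeffX]

/-! ### The polynomials `q` and `p` and the series of types (I) and (II) -/

/-- `r = a x^d + (terms of degree between 1 and d - 1)`, and substituting `r` into
`y y_x + f y + g` cancels all the powers of `x` above `x ^ deg f`. -/
structure IsPrincipalPart (f g : ℂ[X]) (a : ℂ) (d : ℕ) (r : ℂ[X]) : Prop where
  natDegree_eq : r.natDegree = d
  leadingCoeff_eq : r.leadingCoeff = a
  coeff_zero_eq : r.coeff 0 = 0
  residual : (r * derivative r + f * r + g).natDegree ≤ f.natDegree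

/-- The leading coefficient `-f₀ / (m + 1)` of `q`. -/
def leadI (f : ℂ[X]) : ℂ := -f.leadingCoeff / ((f.natDegree : ℂ) + 1)

/-- The leading coefficient `-g₀ / f₀` of `p`. -/
def leadII (f g : ℂ[X]) : ℂ := -g.leadingCoeff / f.leadingCoeff

end Lienard

end

noncomputable section

namespace Lienard

open Differential

/-!
Write `m = deg f`, `ρ(y) = y y′ + f y + g`, and let `y` and `z` be series that agree in their terms
`A x^(m+1)`. If `y - z = s x^i + ⋯`, then `ρ(y) - ρ(z) = (f₀ + (m + 1 + i) A) s x^(m+i) + ⋯`. For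
`A = 0` the factor is `f₀` and never vanishes, so Newton's method produces one series of type (II);
for `A = -f₀ / (m + 1)` it is `i A`, so exactly the coefficient of `x^0` in a series of type (I) is
free and the remaining ones are polynomials in it.

The cofactor of an invariant curve does not involve `y`, and up to a constant factor the curve is a
monic polynomial `W` in `y`. Restricting the invariance identity to a solution `z` of the equation
gives `z W(z)′ = κ W(z)`. After splitting off the powers of `y - y_II`, this identity at `z = y_II`
yields `deg κ < m`. Suppose now that `W` is not constant. The invariance identity shows that the
highest coefficient in `x` of `W(q + c)`, a polynomial in `c`, stands at `x^0`, so that it is monic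
and vanishes at some `c`, and that the equation is solvable for every value of the free coefficient.
For the series `y` of type (I) with free coefficient `c` we then have `deg W(y) < 0`, and comparing
leading terms in `y W(y)′ = κ W(y)` forces `W(y) = 0`. Splitting off this root, induction on the
degree factors `W` completely. Finally, an irreducible `F` remains separable over the field of
series, so the factors are distinct.
-/

/-! ### Orders at infinity -/

@[simp] theorem coeffX_zero (i : ℤ) : coeffX 0 i = 0 := rfl

@[simp] theorem coeffX_add (y z : LaurentSeries ℂ) (i : ℤ) :
    coeffX (y + z) i = coeffX y i + coeffX z i := rfl

@[simp] theorem coeffX_sub (y z : LaurentSeries ℂ) (i : ℤ) :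
    coeffX (y - z) i = coeffX y i - coeffX z i := by
  simp [coeffX]

theorem coeffX_single (n : ℤ) (a : ℂ) (i : ℤ) :
    coeffX (HahnSeries.single n a) i = if i = -n then a else 0 := by
  simp only [coeffX, HahnSeries.coeff_single, neg_eq_iff_eq_neg]

@[simp] theorem coeffX_neg (y : LaurentSeries ℂ) (i : ℤ) : coeffX (-y) i = -coeffX y i := rfl

theorem coeffX_sum {ι : Type*} (s : Finset ι) (w : ι → LaurentSeries ℂ) (i : ℤ) :
    coeffX (∑ j ∈ s, w j) i = ∑ j ∈ s, coeffX (w j) i := by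
  simp only [coeffX, HahnSeries.coeff_sum]

theorem ext_coeffX {y z : LaurentSeries ℂ} (h : ∀ i, coeffX y i = coeffX z i) : y = z := by
  ext i
  simpa [coeffX] using h (-i)

/-- `y = O(x ^ d)` as `x → ∞`: the series `y` has no monomial of degree above `d`. -/
def OrdLE (y : LaurentSeries ℂ) (d : ℤ) : Prop := ∀ i : ℤ, d < i → coeffX y i = 0

theorem ordLE_single (n : ℤ) (a : ℂ) : OrdLE (HahnSeries.single n a) (-n) := fun i hi => by
  rw [coeffX_single, if_neg hi.ne']

theorem ordLE_C (c : ℂ) : OrdLE (HahnSeries.C c) 0 := ordLE_single 0 c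

theorem coeffX_C_zero (c : ℂ) : coeffX (HahnSeries.C c) 0 = c := by
  rw [HahnSeries.C_apply, coeffX_single, if_pos neg_zero.symm]

namespace OrdLE

variable {y z : LaurentSeries ℂ} {d e : ℤ}

theorem zero (d : ℤ) : OrdLE 0 d := fun _ _ => rfl

theorem mono (hy : OrdLE y d) (h : d ≤ e) : OrdLE y e := fun i hi => hy i (h.trans_lt hi)

theorem add (hy : OrdLE y d) (hz : OrdLE z d) : OrdLE (y + z) d := fun i hi => by
  rw [coeffX_add, hy i hi, hz i hi, add_zero]

theorem sub (hy : OrdLE y d) (hz : OrdLE z d) : OrdLE (y - z) d := fun i hi => by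
  rw [coeffX_sub, hy i hi, hz i hi, sub_zero]

theorem sum {ι : Type*} {s : Finset ι} {w : ι → LaurentSeries ℂ} (h : ∀ j ∈ s, OrdLE (w j) d) :
    OrdLE (∑ j ∈ s, w j) d :=
  Finset.sum_induction w (OrdLE · d) (fun _ _ => add) (zero d) h

theorem pred (hy : OrdLE y d) (h : coeffX y d = 0) : OrdLE y (d - 1) := fun i hi => by
  rcases (show d ≤ i by lia).eq_or_lt with rfl | hlt
  · exact h
  · exact hy i hlt

theorem mul (hy : OrdLE y d) (hz : OrdLE z e) : OrdLE (y * z) (d + e) := fun i hi => by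
  rw [coeffX, HahnSeries.coeff_mul]
  refine Finset.sum_eq_zero fun jk hjk => ?_
  have hsum : jk.1 + jk.2 = -i := (Finset.mem_antidiagonal.mp hjk).2.2
  rcases lt_or_ge jk.1 (-d) with hj | hj
  · rw [← neg_neg jk.1, ← coeffX, hy _ (by lia), zero_mul]
  · rw [← neg_neg jk.2, ← coeffX, hz _ (by lia), mul_zero]

theorem coeffX_mul (hy : OrdLE y d) (hz : OrdLE z e) :
    coeffX (y * z) (d + e) = coeffX y d * coeffX z e := by
  rw [coeffX, HahnSeries.coeff_mul, Finset.sum_eq_single (-d, -e)]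
  · rfl
  · intro jk hjk hne
    have hsum : jk.1 + jk.2 = -(d + e) := (Finset.mem_antidiagonal.mp hjk).2.2
    rcases lt_trichotomy jk.1 (-d) with hj | hj | hj
    · rw [← neg_neg jk.1, ← coeffX, hy _ (by lia), zero_mul]
    · exact absurd (Prod.ext hj (by lia)) hne
    · rw [← neg_neg jk.2, ← coeffX, hz _ (by lia), mul_zero]
  · intro hnot
    by_contra h
    exact hnot (Finset.mem_antidiagonal.mpr
      ⟨left_ne_zero_of_mul h, right_ne_zero_of_mul h, by dsimp only; ring⟩)

theorem natCast_mul (hy : OrdLE y d) (n : ℕ) : OrdLE (n * y) d := by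
  rw [← map_natCast HahnSeries.C]
  simpa only [zero_add] using (ordLE_C n).mul hy

theorem pow (hy : OrdLE y 0) (n : ℕ) : OrdLE (y ^ n) 0 := by
  induction n with
  | zero => rw [pow_zero, ← HahnSeries.C_one]; exact ordLE_C 1
  | succ n ih => simpa only [pow_succ, add_zero] using ih.mul hy

theorem coeffX_pow (hy : OrdLE y 0) (n : ℕ) : coeffX (y ^ n) 0 = coeffX y 0 ^ n := by
  induction n with
  | zero => rw [pow_zero, pow_zero, ← HahnSeries.C_one, coeffX_C_zero]
  | succ n ih => rw [pow_succ, pow_succ, ← ih, ← (hy.pow n).coeffX_mul hy, add_zero]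

theorem eq_zero (h : ∀ n : ℕ, OrdLE y (d - n)) : y = 0 :=
  ext_coeffX fun i => h (d - i + 1).toNat i (by lia)

end OrdLE

theorem exists_ordLE_coeffX_ne_zero {y : LaurentSeries ℂ} (hy : y ≠ 0) :
    ∃ d, OrdLE y d ∧ coeffX y d ≠ 0 := by
  refine ⟨-y.order, fun i hi => HahnSeries.coeff_eq_zero_of_lt_order (by lia), ?_⟩
  rw [coeffX, neg_neg]
  exact HahnSeries.coeff_order_eq_zero.not.mpr hy

theorem ordLE_of_ordLE_mul {y u : LaurentSeries ℂ} {d e : ℤ} (hu : OrdLE u d)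
    (hu0 : coeffX u d ≠ 0) (h : OrdLE (y * u) (e + d)) : OrdLE y e := by
  rcases eq_or_ne y 0 with rfl | hy
  · exact .zero e
  obtain ⟨k, hk, hk0⟩ := exists_ordLE_coeffX_ne_zero hy
  rcases le_or_gt k e with hke | hke
  · exact hk.mono hke
  · exact absurd ((hk.coeffX_mul hu).symm.trans (h _ (by lia))) (mul_ne_zero hk0 hu0)

theorem coeffX_tail_neg (c : ℕ → ℂ) (l : ℕ) : coeffX (tail c) (-l) = c l := by
  rw [coeffX, neg_neg, tail, HahnSeries.ofPowerSeries_apply_coeff, PowerSeries.coeff_mk]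

theorem coeffX_tail_zero (c : ℕ → ℂ) : coeffX (tail c) 0 = c 0 := coeffX_tail_neg c 0

theorem ordLE_tail (c : ℕ → ℂ) : OrdLE (tail c) 0 := fun i hi => by
  rw [coeffX, tail, HahnSeries.ofPowerSeries_apply, HahnSeries.embDomain_of_notMem_range]
  rintro ⟨n, hn⟩
  have : (n : ℤ) = -i := hn
  lia

theorem OrdLE.exists_eq_tail {w : LaurentSeries ℂ} (hw : OrdLE w 0) : ∃ c, w = tail c := by
  refine ⟨fun l => coeffX w (-l), ext_coeffX fun i => ?_⟩
  rcases le_or_gt i 0 with hi | hi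
  · obtain ⟨l, rfl⟩ : ∃ l : ℕ, i = -l := ⟨i.natAbs, by lia⟩
    rw [coeffX_tail_neg]
  · rw [hw i hi, ordLE_tail _ i hi]

/-! ### Polynomials as series, and the derivation `d/dx` -/

theorem coeffX_ofPoly_of_neg (p : ℂ[X]) {i : ℤ} (hi : i < 0) : coeffX (ofPoly p) i = 0 := by
  rw [ofPoly, coeffX, coe_eval₂RingHom, eval₂_eq_sum_range, HahnSeries.coeff_sum]
  refine Finset.sum_eq_zero fun j _ => ?_
  have hij : -i ≠ -(j : ℤ) := by lia
  simp [HahnSeries.coeff_single_of_ne hij]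

theorem ordLE_ofPoly_iff {p : ℂ[X]} {d : ℕ} : OrdLE (ofPoly p) d ↔ p.natDegree ≤ d := by
  refine ⟨fun h => natDegree_le_iff_coeff_eq_zero.mpr fun i hi => ?_, fun h i hi => ?_⟩
  · rw [← coeffX_ofPoly, h _ (by exact_mod_cast hi)]
  · obtain ⟨j, rfl⟩ := Int.eq_ofNat_of_zero_le (show 0 ≤ i by lia)
    rw [coeffX_ofPoly, coeff_eq_zero_of_natDegree_lt (by lia)]

theorem eq_zero_of_ordLE_ofPoly_neg_one {p : ℂ[X]} (h : OrdLE (ofPoly p) (-1)) : p = 0 := by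
  ext i
  rw [← coeffX_ofPoly, h _ (by lia), coeff_zero]

theorem ofPoly_injective : Function.Injective ofPoly := fun p r h => by
  ext i
  rw [← coeffX_ofPoly, ← coeffX_ofPoly, h]

/-- The Euler operator `x d/dx`. Unlike `d/dx` it does not shift supports, which makes its Leibniz
rule a termwise identity. -/
def eulerX (y : LaurentSeries ℂ) : LaurentSeries ℂ where
  coeff i := -i * y.coeff i
  isPWO_support' := y.isPWO_support.mono fun _ hi => right_ne_zero_of_mul hi

theorem derivX_eq_single_mul_eulerX (y : LaurentSeries ℂ) :
    derivX y = HahnSeries.single 1 1 * eulerX y := by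
  refine ext_coeffX fun i => ?_
  rw [show i = i + 1 - 1 by ring, coeffX_derivX, coeffX, coeffX, HahnSeries.coeff_single_mul,
    one_mul]
  simp only [eulerX]
  push_cast
  ring_nf

theorem eulerX_mul (y z : LaurentSeries ℂ) : eulerX (y * z) = y * eulerX z + z * eulerX y := by
  have hsupp : ∀ w : LaurentSeries ℂ, (eulerX w).support ⊆ w.support := fun _ _ hi =>
    right_ne_zero_of_mul hi
  ext i
  rw [HahnSeries.coeff_add, mul_comm z, HahnSeries.coeff_mul_right' z.isPWO_support (hsupp z),
    HahnSeries.coeff_mul_left' y.isPWO_support (hsupp y)]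
  simp only [eulerX]
  rw [HahnSeries.coeff_mul, Finset.mul_sum, ← Finset.sum_add_distrib]
  refine Finset.sum_congr rfl fun jk hjk => ?_
  rw [← (Finset.mem_antidiagonal.mp hjk).2.2]
  push_cast
  ring

theorem derivX_mul (y z : LaurentSeries ℂ) : derivX (y * z) = y * derivX z + z * derivX y := by
  simp only [derivX_eq_single_mul_eulerX, eulerX_mul]
  ring

/-- The differential ring structure given by an additive map that satisfies the Leibniz rule. It is
stated for an abstract ring because `LaurentSeries ℂ` carries a second `ℤ`-algebra structure, which
instance search would find first. -/
abbrev differentialOfLeibniz {R : Type*} [CommRing R] (D : R →+ R)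
    (hD : ∀ a b, D (a * b) = a * D b + b * D a) : Differential R where
  deriv := .mk' D.toIntLinearMap fun a b => by simpa using hD a b

/-- The derivation `d/dx`, in the form that gives access to the notation `y′` and to the
coefficientwise derivation `Differential.mapCoeffs` of polynomials in `y`. -/
instance : Differential (LaurentSeries ℂ) :=
  differentialOfLeibniz
    (.mk' derivX fun y z => by simp only [derivX, map_add, mul_add, neg_add]) derivX_mul

theorem deriv_eq_derivX (y : LaurentSeries ℂ) : y′ = derivX y := rfl

theorem OrdLE.deriv {y : LaurentSeries ℂ} {d : ℤ} (hy : OrdLE y d) : OrdLE y′ (d - 1) :=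
  fun i hi => by
    rw [show i = i + 1 - 1 by ring, deriv_eq_derivX, coeffX_derivX, hy _ (by lia), mul_zero]

theorem deriv_C (c : ℂ) : (HahnSeries.C c : LaurentSeries ℂ)′ = 0 := ext_coeffX fun i => by
  rw [show i = i + 1 - 1 by ring, deriv_eq_derivX, coeffX_derivX, HahnSeries.C_apply,
    coeffX_single, coeffX_zero]
  split_ifs with hi <;> simp [hi]

theorem deriv_ofPoly (p : ℂ[X]) : (ofPoly p)′ = ofPoly (derivative p) := by
  refine ext_coeffX fun i => ?_
  rw [deriv_eq_derivX, show i = i + 1 - 1 by ring, coeffX_derivX, add_sub_cancel_right]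
  rcases lt_trichotomy i (-1) with hi | rfl | hi
  · rw [coeffX_ofPoly_of_neg _ (by lia), coeffX_ofPoly_of_neg _ (by lia), mul_zero]
  · rw [coeffX_ofPoly_of_neg (derivative p) (by decide)]
    simp
  · lift i to ℕ using (by lia)
    rw [coeffX_ofPoly, coeff_derivative, ← coeffX_ofPoly, mul_comm]
    push_cast
    rfl

/-! ### Darboux polynomials over a differential ring -/

section DifferentialRing

variable {K : Type*} [CommRing K] [Differential K] {φ γ : K}

/-- The left-hand side of the equation `y y′ + φ y + γ = 0`. -/
def residual (φ γ y : K) : K := y * y′ + φ * y + γ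

/-- The residual of a family of series, given as a polynomial in a constant parameter. -/
def residualPoly (φ γ : K) (W : K[X]) : K[X] := W * Differential.mapCoeffs W + C φ * W + C γ

/-- The vector field `y ∂ - (φ y + γ) ∂/∂y` on `K[y]`, where `∂` differentiates the coefficients. -/
def vectorField (φ γ : K) : Derivation ℤ K[X] K[X] :=
  (X : K[X]) • Differential.mapCoeffs - (C φ * X + C γ) • derivative'.restrictScalars ℤ

/-- `W` is a Darboux polynomial of `vectorField φ γ` with cofactor `κ`. Only cofactors that do not
depend on `y` occur here. -/
def IsDarboux (φ γ : K) (W : K[X]) (κ : K) : Prop := vectorField φ γ W = C κ * W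

theorem deriv_eval (W : K[X]) (s : K) :
    (W.eval s)′ = (Differential.mapCoeffs W).eval s + (derivative W).eval s * s′ := by
  simpa only [coe_aeval_eq_eval] using Differential.deriv_aeval_eq s W

theorem eval_residualPoly {c : K} (hc : c′ = 0) (W : K[X]) :
    (residualPoly φ γ W).eval c = residual φ γ (W.eval c) := by
  simp only [residualPoly, residual, deriv_eval, hc, eval_add, eval_mul, eval_C, mul_zero, add_zero]

theorem vectorField_apply (W : K[X]) : vectorField φ γ W =
    X * Differential.mapCoeffs W - (C φ * X + C γ) * derivative W := rfl

theorem eval_vectorField (W : K[X]) (s : K) : (vectorField φ γ W).eval s =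
    s * (W.eval s)′ - residual φ γ s * (derivative W).eval s := by
  simp only [vectorField_apply, residual, deriv_eval, eval_sub, eval_mul, eval_add, eval_X, eval_C]
  ring

namespace IsDarboux

variable {V W : K[X]} {κ κ' z : K}

theorem mul (hV : IsDarboux φ γ V κ) (hW : IsDarboux φ γ W κ') :
    IsDarboux φ γ (V * W) (κ + κ') := by
  rw [IsDarboux, Derivation.leibniz, hV, hW, smul_eq_mul, smul_eq_mul, C_add]
  ring

theorem C_of_deriv_eq_zero {c : K} (hc : c′ = 0) : IsDarboux φ γ (C c) 0 := by
  rw [IsDarboux, vectorField_apply, Differential.mapCoeffs_C, hc, derivative_C, map_zero, mul_zero,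
    mul_zero, sub_zero, zero_mul]

theorem cofactor_one (h : IsDarboux φ γ 1 κ) : κ = 0 := by
  rwa [IsDarboux, Derivation.map_one_eq_zero, mul_one, eq_comm, C_eq_zero] at h

theorem pow (hW : IsDarboux φ γ W κ) (k : ℕ) : IsDarboux φ γ (W ^ k) (k * κ) := by
  induction k with
  | zero => simp [IsDarboux]
  | succ k ih =>
    rw [pow_succ, Nat.cast_succ, add_mul, one_mul]
    exact ih.mul hW

theorem of_mul [IsDomain K] (hW0 : W ≠ 0) (hVW : IsDarboux φ γ (V * W) κ)
    (hW : IsDarboux φ γ W κ') : IsDarboux φ γ V (κ - κ') := by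
  refine mul_left_cancel₀ hW0 ?_
  rw [IsDarboux, Derivation.leibniz, hW, smul_eq_mul, smul_eq_mul] at hVW
  rw [C_sub]
  linear_combination hVW

theorem of_const_mul [IsDomain K] {c : K} (hc0 : c ≠ 0) (hc : c′ = 0)
    (h : IsDarboux φ γ (C c * V) κ) : IsDarboux φ γ V κ := by
  rw [mul_comm] at h
  simpa only [sub_zero] using of_mul (C_ne_zero.mpr hc0) h (C_of_deriv_eq_zero hc)

theorem X_sub_C (hz : residual φ γ z = 0) : IsDarboux φ γ (X - C z) (-(φ + z′)) := by
  rw [residual] at hz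
  have hγ : γ = -(z * z′ + φ * z) := by linear_combination hz
  rw [IsDarboux, vectorField_apply, hγ]
  simp only [map_sub, map_neg, map_add, map_mul, Differential.mapCoeffs_X, Differential.mapCoeffs_C,
    derivative_X, derivative_C]
  ring

theorem mul_deriv_eval (hW : IsDarboux φ γ W κ) (hz : residual φ γ z = 0) :
    z * (W.eval z)′ = κ * W.eval z := by
  have h := congrArg (eval z) hW
  rwa [eval_vectorField, hz, zero_mul, sub_zero, eval_mul, eval_C] at h

theorem exists_eq_mul_pow [IsDomain K] (hW : IsDarboux φ γ W κ) (hW0 : W ≠ 0)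
    (hz : residual φ γ z = 0) : ∃ (V : K[X]) (k : ℕ), W = V * (X - C z) ^ k ∧
      V.eval z ≠ 0 ∧ IsDarboux φ γ V (κ + k * (φ + z′)) := by
  obtain ⟨V, hV, hdvd⟩ := exists_eq_pow_rootMultiplicity_mul_and_not_dvd W hW0 z
  rw [mul_comm] at hV
  refine ⟨V, _, hV, fun h => hdvd (dvd_iff_isRoot.mpr h), ?_⟩
  convert of_mul (pow_ne_zero _ (X_sub_C_ne_zero z)) (hV ▸ hW) ((X_sub_C hz).pow _) using 1
  ring

end IsDarboux

end DifferentialRing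

/-! ### Linearization of the equation at infinity -/

section Linearization

variable {f g : ℂ[X]} {A : ℂ} {y z w : LaurentSeries ℂ} {e : ℤ}

theorem isSolution_iff_residual_eq_zero :
    IsSolution f g y ↔ residual (ofPoly f) (ofPoly g) y = 0 := Iff.rfl

/-- `y = A x ^ (deg f + 1) + O(x ^ deg f)`, where `A` may vanish: the series of type (I) have
`A = leadI f`, those of type (II) have `A = 0`. -/
structure HasTopCoeff (f : ℂ[X]) (A : ℂ) (y : LaurentSeries ℂ) : Prop where
  ordLE : OrdLE y (f.natDegree + 1)
  coeffX_eq : coeffX y (f.natDegree + 1) = A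

/-- The indicial polynomial: changing `y = A x ^ (deg f + 1) + ⋯` by `s x ^ i + ⋯` changes
`y y′ + f y + g` by `indicial f A i * s * x ^ (deg f + i) + ⋯`. -/
def indicial (f : ℂ[X]) (A : ℂ) (i : ℤ) : ℂ := f.leadingCoeff + (f.natDegree + 1 + i) * A

/-- The only possible root of the indicial polynomial among the integers is `0`. -/
def Nonresonant (f : ℂ[X]) (A : ℂ) : Prop := ∀ i : ℤ, i ≠ 0 → indicial f A i ≠ 0

theorem residual_sub {K : Type*} [CommRing K] [Differential K] (φ γ y z : K) :
    residual φ γ y - residual φ γ z = y * (y - z)′ + (z′ + φ) * (y - z) := by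
  simp only [residual, map_sub]
  ring

theorem hasTopCoeff_ofPoly {p : ℂ[X]} (hp : p.natDegree ≤ f.natDegree + 1)
    (hA : p.coeff (f.natDegree + 1) = A) : HasTopCoeff f A (ofPoly p) where
  ordLE := by exact_mod_cast ordLE_ofPoly_iff.mpr hp
  coeffX_eq := by rw [← Nat.cast_succ, coeffX_ofPoly, hA]

theorem HasTopCoeff.add (hy : HasTopCoeff f A y) (hw : OrdLE w f.natDegree) :
    HasTopCoeff f A (y + w) where
  ordLE := hy.ordLE.add (hw.mono (by lia))
  coeffX_eq := by rw [coeffX_add, hy.coeffX_eq, hw _ (by lia), add_zero]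

theorem HasTopCoeff.ordLE_deriv_add (hz : HasTopCoeff f A z) :
    OrdLE (z′ + ofPoly f) f.natDegree := by
  have hz' := hz.ordLE.deriv
  rw [add_sub_cancel_right] at hz'
  exact hz'.add (ordLE_ofPoly_iff.mpr le_rfl)

theorem HasTopCoeff.coeffX_deriv_add (hz : HasTopCoeff f A z) :
    coeffX (z′ + ofPoly f) f.natDegree = indicial f A 0 := by
  have hz' := coeffX_derivX z (f.natDegree + 1)
  rw [add_sub_cancel_right, hz.coeffX_eq] at hz'
  rw [coeffX_add, deriv_eq_derivX, hz', coeffX_ofPoly, indicial, leadingCoeff]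
  push_cast
  ring

theorem ordLE_residual_sub (hy : HasTopCoeff f A y) (hz : HasTopCoeff f A z)
    (h : OrdLE (y - z) e) :
    OrdLE (residual (ofPoly f) (ofPoly g) y - residual (ofPoly f) (ofPoly g) z)
      (f.natDegree + e) := by
  rw [residual_sub]
  exact ((hy.ordLE.mul h.deriv).mono (by lia)).add (hz.ordLE_deriv_add.mul h)

theorem coeffX_residual_sub (hy : HasTopCoeff f A y) (hz : HasTopCoeff f A z)
    (h : OrdLE (y - z) e) :
    coeffX (residual (ofPoly f) (ofPoly g) y - residual (ofPoly f) (ofPoly g) z)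
      (f.natDegree + e) = indicial f A e * coeffX (y - z) e := by
  have h1 := hy.ordLE.coeffX_mul h.deriv
  rw [show (f.natDegree : ℤ) + 1 + (e - 1) = f.natDegree + e by ring, hy.coeffX_eq,
    deriv_eq_derivX, coeffX_derivX] at h1
  rw [residual_sub, coeffX_add, deriv_eq_derivX, h1, hz.ordLE_deriv_add.coeffX_mul h,
    hz.coeffX_deriv_add, indicial, indicial]
  push_cast
  ring

theorem Nonresonant.ordLE_sub (hA : Nonresonant f A) (hy : HasTopCoeff f A y)
    (hz : HasTopCoeff f A z) {k : ℕ}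
    (h : OrdLE (residual (ofPoly f) (ofPoly g) y - residual (ofPoly f) (ofPoly g) z)
      (f.natDegree + k)) : OrdLE (y - z) k := by
  rcases eq_or_ne (y - z) 0 with h0 | h0
  · rw [h0]
    exact .zero k
  obtain ⟨e, he, he0⟩ := exists_ordLE_coeffX_ne_zero h0
  rcases le_or_gt e k with hek | hek
  · exact he.mono hek
  · have hcoeff := coeffX_residual_sub (g := g) hy hz he
    rw [h _ (by lia)] at hcoeff
    exact absurd hcoeff.symm (mul_ne_zero (hA e (by lia)) he0)

/-- One step of Newton's method. -/
theorem HasTopCoeff.ordLE_residual_add (hy : HasTopCoeff f A y)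
    (hres : OrdLE (residual (ofPoly f) (ofPoly g) y) (f.natDegree + e)) (hw : OrdLE w e)
    (he : e ≤ f.natDegree)
    (hcoeff : coeffX (residual (ofPoly f) (ofPoly g) y) (f.natDegree + e) +
      indicial f A e * coeffX w e = 0) :
    OrdLE (residual (ofPoly f) (ofPoly g) (y + w)) (f.natDegree + e - 1) := by
  have hyw := hy.add (hw.mono he)
  have hsub : OrdLE (y + w - y) e := by rwa [add_sub_cancel_left]
  have h1 := ordLE_residual_sub (g := g) hyw hy hsub
  have h2 := coeffX_residual_sub (g := g) hyw hy hsub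
  rw [add_sub_cancel_left, coeffX_sub] at h2
  refine .pred (by simpa only [sub_add_cancel] using h1.add hres) ?_
  linear_combination h2 + hcoeff

end Linearization

/-! ### The polynomial parts `q` and `p` -/

section PrincipalPart

variable {f g q r : ℂ[X]} {A : ℂ}

/-- `q` is a polynomial without constant term that solves `y y′ + f y + g = 0` up to terms of degree
at most `deg f`, with `x ^ (deg f + 1)` having the coefficient `A` in `q`. -/
structure IsApproxSolution (f g : ℂ[X]) (A : ℂ) (q : ℂ[X]) : Prop where
  hasTopCoeff : HasTopCoeff f A (ofPoly q)
  coeff_zero_eq : q.coeff 0 = 0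
  ordLE_residual : OrdLE (residual (ofPoly f) (ofPoly g) (ofPoly q)) f.natDegree

theorem residual_ofPoly (f g r : ℂ[X]) : residual (ofPoly f) (ofPoly g) (ofPoly r) =
    ofPoly (r * derivative r + f * r + g) := by
  simp only [residual, deriv_ofPoly, map_add, map_mul]

theorem IsPrincipalPart.isApproxSolution {a : ℂ} {d : ℕ} (hd : d ≤ f.natDegree + 1)
    (h : IsPrincipalPart f g a d r) :
    IsApproxSolution f g ((monomial d a).coeff (f.natDegree + 1)) r where
  hasTopCoeff := hasTopCoeff_ofPoly (h.natDegree_eq.trans_le hd) <| by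
    rw [coeff_monomial]
    split_ifs with hd'
    · rw [← hd', ← h.natDegree_eq, ← h.leadingCoeff_eq, leadingCoeff]
    · exact coeff_eq_zero_of_natDegree_lt (by have := h.natDegree_eq; lia)
  coeff_zero_eq := h.coeff_zero_eq
  ordLE_residual := by
    rw [residual_ofPoly]
    exact ordLE_ofPoly_iff.mpr h.residual

theorem IsApproxSolution.ordLE_sub_ofPoly {y : LaurentSeries ℂ} (hA : Nonresonant f A)
    (hq : IsApproxSolution f g A q) (hy : HasTopCoeff f A y)
    (hres : OrdLE (residual (ofPoly f) (ofPoly g) y) f.natDegree) : OrdLE (y - ofPoly q) 0 :=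
  hA.ordLE_sub (g := g) (k := 0) hy hq.hasTopCoeff
    (by simpa using hres.sub hq.ordLE_residual)

theorem IsPrincipalPart.isApproxSolution_leadI
    (h : IsPrincipalPart f g (leadI f) (f.natDegree + 1) r) :
    IsApproxSolution f g (leadI f) r := by
  simpa only [coeff_monomial_same] using h.isApproxSolution le_rfl

theorem IsPrincipalPart.isApproxSolution_zero {a : ℂ} {d : ℕ} (hd : d ≤ f.natDegree)
    (h : IsPrincipalPart f g a d r) : IsApproxSolution f g 0 r := by
  simpa only [coeff_monomial_of_ne a (show f.natDegree + 1 ≠ d by lia)] using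
    h.isApproxSolution (by lia)

theorem IsApproxSolution.eq (hA : Nonresonant f A) (hr : IsApproxSolution f g A r)
    (hq : IsApproxSolution f g A q) : r = q := by
  have h := hq.ordLE_sub_ofPoly hA hr.hasTopCoeff hr.ordLE_residual
  ext i
  rcases i.eq_zero_or_pos with rfl | hi
  · rw [hr.coeff_zero_eq, hq.coeff_zero_eq]
  · rw [← sub_eq_zero, ← coeffX_ofPoly, ← coeffX_ofPoly, ← coeffX_sub, h _ (by exact_mod_cast hi)]

theorem exists_ordLE_residual_add (hA : Nonresonant f A) {e : ℕ} (he : e ≤ f.natDegree)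
    (hr : HasTopCoeff f A (ofPoly r))
    (hres : OrdLE (residual (ofPoly f) (ofPoly g) (ofPoly r)) (f.natDegree + e)) :
    ∃ s : ℂ[X], s.natDegree ≤ e ∧ s.coeff 0 = 0 ∧
      OrdLE (residual (ofPoly f) (ofPoly g) (ofPoly (r + s))) f.natDegree := by
  induction e generalizing r with
  | zero => exact ⟨0, by simp, coeff_zero 0, by simpa using hres⟩
  | succ e ih =>
    have hind := hA (e + 1 : ℕ) (by lia)
    set β : ℂ := -coeffX (residual (ofPoly f) (ofPoly g) (ofPoly r)) (f.natDegree + (e + 1 : ℕ)) /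
      indicial f A (e + 1 : ℕ) with hβ
    have hw : OrdLE (ofPoly (monomial (e + 1) β)) (e + 1 : ℕ) :=
      ordLE_ofPoly_iff.mpr (natDegree_monomial_le β)
    have hstep := hr.ordLE_residual_add hres hw (by exact_mod_cast he) <| by
      rw [coeffX_ofPoly, coeff_monomial_same, hβ]
      field_simp
      ring
    rw [← map_add] at hstep
    have htop : HasTopCoeff f A (ofPoly (r + monomial (e + 1) β)) := by
      rw [map_add]
      exact hr.add (hw.mono (by exact_mod_cast he))
    obtain ⟨s, hs, hs0, hsres⟩ := ih (by lia) htop (hstep.mono (by lia))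
    refine ⟨monomial (e + 1) β + s, ?_, ?_, by rwa [← add_assoc]⟩
    · exact natDegree_add_le_of_degree_le (natDegree_monomial_le β) (hs.trans e.le_succ)
    · rw [coeff_add, coeff_monomial_of_ne _ (Nat.succ_ne_zero e).symm, hs0, add_zero]

theorem exists_isPrincipalPart {a : ℂ} {d : ℕ} (ha : a ≠ 0) (hd : 1 ≤ d)
    (hdf : d ≤ f.natDegree + 1) (hA : Nonresonant f ((monomial d a).coeff (f.natDegree + 1)))
    (hres : OrdLE (residual (ofPoly f) (ofPoly g) (ofPoly (monomial d a)))
      (f.natDegree + (d - 1 : ℕ))) : ∃ r, IsPrincipalPart f g a d r := by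
  have htop : HasTopCoeff f ((monomial d a).coeff (f.natDegree + 1)) (ofPoly (monomial d a)) :=
    hasTopCoeff_ofPoly ((natDegree_monomial_le a).trans hdf) rfl
  obtain ⟨s, hs, hs0, hsres⟩ := exists_ordLE_residual_add hA (by lia) htop hres
  have hlt : s.natDegree < (monomial d a).natDegree := by
    rw [natDegree_monomial_eq d ha]
    lia
  rw [residual_ofPoly, ordLE_ofPoly_iff] at hsres
  refine ⟨monomial d a + s, ?_, ?_, ?_, hsres⟩
  · rw [natDegree_add_eq_left_of_natDegree_lt hlt, natDegree_monomial_eq d ha]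
  · rw [leadingCoeff_add_of_degree_lt' (degree_lt_degree hlt), leadingCoeff_monomial]
  · rw [coeff_add, coeff_monomial_of_ne a (by lia), hs0, add_zero]

theorem indicial_leadI (f : ℂ[X]) (i : ℤ) : indicial f (leadI f) i = i * leadI f := by
  have : (f.natDegree : ℂ) + 1 ≠ 0 := Nat.cast_add_one_ne_zero _
  rw [indicial, leadI]
  field_simp
  ring

theorem indicial_zero (f : ℂ[X]) (i : ℤ) : indicial f 0 i = f.leadingCoeff := by
  rw [indicial, mul_zero, add_zero]

theorem leadI_ne_zero (hf : f ≠ 0) : leadI f ≠ 0 :=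
  div_ne_zero (neg_ne_zero.mpr (leadingCoeff_ne_zero.mpr hf)) (Nat.cast_add_one_ne_zero _)

theorem leadII_ne_zero (hf : f ≠ 0) (hfg : f.natDegree < g.natDegree) : leadII f g ≠ 0 :=
  div_ne_zero (neg_ne_zero.mpr (leadingCoeff_ne_zero.mpr (ne_zero_of_natDegree_gt hfg)))
    (leadingCoeff_ne_zero.mpr hf)

theorem nonresonant_leadI (hf : f ≠ 0) : Nonresonant f (leadI f) := fun i hi => by
  rw [indicial_leadI]
  exact mul_ne_zero (Int.cast_ne_zero.mpr hi) (leadI_ne_zero hf)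

theorem nonresonant_zero (hf : f ≠ 0) : Nonresonant f 0 := fun i _ => by
  rw [indicial_zero]
  exact leadingCoeff_ne_zero.mpr hf

theorem residual_eq {K : Type*} [CommRing K] [Differential K] (φ γ y : K) :
    residual φ γ y = (y′ + φ) * y + γ := by
  rw [residual]
  ring

theorem exists_isPrincipalPart_leadI (hf : f ≠ 0) (hgf : g.natDegree < 2 * f.natDegree + 1) :
    ∃ q, IsPrincipalPart f g (leadI f) (f.natDegree + 1) q := by
  refine exists_isPrincipalPart (leadI_ne_zero hf) (by lia) le_rfl ?_ ?_
  · rw [coeff_monomial_same]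
    exact nonresonant_leadI hf
  have htop : HasTopCoeff f (leadI f) (ofPoly (monomial (f.natDegree + 1) (leadI f))) :=
    hasTopCoeff_ofPoly (natDegree_monomial_le _) (coeff_monomial_same _ _)
  have hfac := htop.ordLE_deriv_add.pred <| by
    rw [htop.coeffX_deriv_add, indicial_leadI, Int.cast_zero, zero_mul]
  rw [residual_eq]
  exact ((hfac.mul htop.ordLE).mono (by lia)).add
    ((ordLE_ofPoly_iff.mpr le_rfl).mono (by lia))

theorem exists_isPrincipalPart_leadII (hf : f ≠ 0) (hfg : f.natDegree < g.natDegree)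
    (hgf : g.natDegree < 2 * f.natDegree + 1) :
    ∃ p, IsPrincipalPart f g (leadII f g) (g.natDegree - f.natDegree) p := by
  obtain ⟨d, hd⟩ := Nat.exists_eq_add_of_lt hfg
  rw [show g.natDegree - f.natDegree = d + 1 by lia]
  have hd0 : (monomial (d + 1) (leadII f g)).coeff (f.natDegree + 1) = 0 :=
    coeff_monomial_of_ne _ (by lia)
  have hy : OrdLE (ofPoly (monomial (d + 1) (leadII f g))) (d + 1 : ℕ) :=
    ordLE_ofPoly_iff.mpr (natDegree_monomial_le _)
  have htop : HasTopCoeff f 0 (ofPoly (monomial (d + 1) (leadII f g))) :=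
    hasTopCoeff_ofPoly ((natDegree_monomial_le _).trans (by lia)) hd0
  refine exists_isPrincipalPart (leadII_ne_zero hf hfg) (by lia) (by lia) ?_ ?_
  · rw [hd0]
    exact nonresonant_zero hf
  have hdeg : (f.natDegree : ℤ) + (d + 1 : ℕ) = g.natDegree := by lia
  have hcoeff := htop.ordLE_deriv_add.coeffX_mul hy
  have hord := htop.ordLE_deriv_add.mul hy
  rw [htop.coeffX_deriv_add, indicial_zero, coeffX_ofPoly, coeff_monomial_same, hdeg] at hcoeff
  rw [hdeg] at hord
  have hcancel := (hord.add (ordLE_ofPoly_iff.mpr le_rfl)).pred <| by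
    rw [coeffX_add, hcoeff, coeffX_ofPoly, coeff_natDegree, leadII,
      mul_div_cancel₀ _ (leadingCoeff_ne_zero.mpr hf), neg_add_cancel]
  rw [residual_eq]
  exact hcancel.mono (by lia)

end PrincipalPart

/-! ### Series solutions with a given polynomial part -/

section SeriesSolution

/-- The coefficient of `x ^ i` in `V`, as a polynomial in the variable of `V`. -/
def coeffPoly (V : (LaurentSeries ℂ)[X]) (i : ℤ) : ℂ[X] := V.sum fun j y => monomial j (coeffX y i)

theorem coeff_coeffPoly (V : (LaurentSeries ℂ)[X]) (i : ℤ) (j : ℕ) :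
    (coeffPoly V i).coeff j = coeffX (V.coeff j) i := by
  rw [coeffPoly, Polynomial.sum_def, finsetSum_coeff]
  simp only [coeff_monomial]
  rw [Finset.sum_ite_eq' V.support j]
  split_ifs with h
  · rfl
  · rw [notMem_support_iff.mp h, coeffX_zero]

theorem eval_coeffPoly_eq_sum (V : (LaurentSeries ℂ)[X]) (i : ℤ) (c : ℂ) :
    (coeffPoly V i).eval c = ∑ j ∈ V.support, coeffX (V.coeff j) i * c ^ j := by
  simp only [coeffPoly, Polynomial.sum_def, eval_finsetSum, eval_monomial]

theorem eval_coeffPoly (V : (LaurentSeries ℂ)[X]) (i : ℤ) (c : ℂ) :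
    (coeffPoly V i).eval c = coeffX (V.eval (HahnSeries.C c)) i := by
  rw [eval_coeffPoly_eq_sum, eval_eq_sum, Polynomial.sum_def, coeffX_sum]
  refine Finset.sum_congr rfl fun j _ => ?_
  rw [← map_pow, mul_comm (V.coeff j), HahnSeries.C_mul_eq_smul, coeffX, coeffX,
    HahnSeries.coeff_smul, smul_eq_mul, mul_comm]

/-- The successive Newton approximations of the solutions of the form `q + c + O(x⁻¹)` of
`y y′ + f y + g = 0`, as polynomials in the free constant `c`. -/
def approximant (f g : ℂ[X]) (A : ℂ) (q : ℂ[X]) : ℕ → (LaurentSeries ℂ)[X]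
  | 0 => X + C (ofPoly q)
  | l + 1 => approximant f g A q l +
      C (HahnSeries.single (l + 1 : ℤ) (-(indicial f A (-(l + 1)))⁻¹)) *
        (coeffPoly (residualPoly (ofPoly f) (ofPoly g) (approximant f g A q l))
          (f.natDegree - (l + 1))).map HahnSeries.C

/-- The coefficient of `x ^ (-l)` in the solutions of the form `q + c + O(x⁻¹)`, as a polynomial in
the free constant `c`. -/
def seriesCoeff (f g : ℂ[X]) (A : ℂ) (q : ℂ[X]) (l : ℕ) : ℂ[X] :=
  coeffPoly (approximant f g A q l) (-l)

variable {f g q : ℂ[X]} {A c : ℂ} {y : LaurentSeries ℂ}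

theorem eval_approximant_zero : (approximant f g A q 0).eval (HahnSeries.C c) =
    ofPoly q + HahnSeries.C c := by
  rw [approximant, eval_add, eval_X, eval_C, add_comm]

theorem eval_approximant_succ (l : ℕ) : (approximant f g A q (l + 1)).eval (HahnSeries.C c) =
    (approximant f g A q l).eval (HahnSeries.C c) +
      HahnSeries.single (l + 1 : ℤ) (-(indicial f A (-(l + 1)))⁻¹ *
        coeffX (residual (ofPoly f) (ofPoly g) ((approximant f g A q l).eval (HahnSeries.C c)))
          (f.natDegree - (l + 1))) := by
  rw [approximant, eval_add, eval_mul, eval_C, eval_map, eval₂_at_apply, eval_coeffPoly,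
    eval_residualPoly (deriv_C c), HahnSeries.C_apply (a := coeffX _ _),
    HahnSeries.single_mul_single, add_zero]

theorem eval_seriesCoeff (l : ℕ) : (seriesCoeff f g A q l).eval c =
    coeffX ((approximant f g A q l).eval (HahnSeries.C c)) (-l) :=
  eval_coeffPoly _ _ _

theorem IsApproxSolution.coeffX_zero_eq (hq : IsApproxSolution f g A q) :
    coeffX (ofPoly q) 0 = 0 := by
  rw [← Nat.cast_zero, coeffX_ofPoly, hq.coeff_zero_eq]

theorem IsApproxSolution.coeffX_add_tail (hq : IsApproxSolution f g A q) (c : ℕ → ℂ) (l : ℕ) :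
    coeffX (ofPoly q + tail c) (-l) = c l := by
  rw [coeffX_add, coeffX_tail_neg, add_eq_right]
  rcases l.eq_zero_or_pos with rfl | hl
  · rw [Nat.cast_zero, neg_zero, hq.coeffX_zero_eq]
  · exact coeffX_ofPoly_of_neg q (by lia)

theorem IsApproxSolution.hasTopCoeff_add (hq : IsApproxSolution f g A q) {w : LaurentSeries ℂ}
    (hw : OrdLE w 0) : HasTopCoeff f A (ofPoly q + w) :=
  hq.hasTopCoeff.add (hw.mono (by lia))

theorem IsApproxSolution.ordLE_residual_add (hq : IsApproxSolution f g A q)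
    {w : LaurentSeries ℂ} (hw : OrdLE w 0) :
    OrdLE (residual (ofPoly f) (ofPoly g) (ofPoly q + w)) f.natDegree := by
  have h := ordLE_residual_sub (g := g) (hq.hasTopCoeff_add hw) hq.hasTopCoeff
    (by rwa [add_sub_cancel_left])
  simpa only [sub_add_cancel] using (h.mono (by lia)).add hq.ordLE_residual

theorem IsApproxSolution.coeffX_residual_add (hq : IsApproxSolution f g A q)
    {w : LaurentSeries ℂ} (hw : OrdLE w 0) :
    coeffX (residual (ofPoly f) (ofPoly g) (ofPoly q + w)) f.natDegree =
      coeffX (residual (ofPoly f) (ofPoly g) (ofPoly q)) f.natDegree +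
        indicial f A 0 * coeffX w 0 := by
  have h := coeffX_residual_sub (g := g) (e := 0) (hq.hasTopCoeff_add hw) hq.hasTopCoeff
    (by rwa [add_sub_cancel_left])
  rw [add_zero, add_sub_cancel_left, coeffX_sub] at h
  linear_combination h

theorem IsApproxSolution.hasTopCoeff_approximant (hq : IsApproxSolution f g A q) (c : ℂ) (l : ℕ) :
    HasTopCoeff f A ((approximant f g A q l).eval (HahnSeries.C c)) := by
  induction l with
  | zero =>
    rw [eval_approximant_zero]
    exact hq.hasTopCoeff_add (ordLE_C c)
  | succ l ih =>
    rw [eval_approximant_succ]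
    exact ih.add ((ordLE_single _ _).mono (by lia))

theorem IsApproxSolution.ordLE_residual_approximant (hA : Nonresonant f A)
    (hq : IsApproxSolution f g A q)
    (hc : coeffX (residual (ofPoly f) (ofPoly g) (ofPoly q)) f.natDegree + indicial f A 0 * c = 0)
    (l : ℕ) : OrdLE (residual (ofPoly f) (ofPoly g) ((approximant f g A q l).eval (HahnSeries.C c)))
      (f.natDegree - (l + 1)) := by
  induction l with
  | zero =>
    rw [eval_approximant_zero]
    refine ((hq.ordLE_residual_add (ordLE_C c)).pred ?_).mono (by lia)
    rwa [hq.coeffX_residual_add (ordLE_C c), coeffX_C_zero]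
  | succ l ih =>
    have hind := hA (-(l + 1)) (by lia)
    rw [eval_approximant_succ]
    rw [sub_eq_add_neg] at ih ⊢
    refine ((hq.hasTopCoeff_approximant c l).ordLE_residual_add ih (ordLE_single _ _) (by lia)
      ?_).mono (by push_cast; lia)
    rw [coeffX_single, if_pos rfl]
    field_simp
    ring

theorem ordLE_sub_approximant_zero (h : OrdLE (y - ofPoly q) 0) (hc : coeffX (y - ofPoly q) 0 = c) :
    OrdLE (y - (approximant f g A q 0).eval (HahnSeries.C c)) (-1) := by
  rw [eval_approximant_zero, ← sub_sub]
  exact (h.sub (ordLE_C c)).pred (by rw [coeffX_sub, hc, coeffX_C_zero, sub_self])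

theorem ordLE_sub_approximant_succ {l : ℕ}
    (h : OrdLE (y - (approximant f g A q l).eval (HahnSeries.C c)) (-(l + 1)))
    (hy : coeffX y (-(l + 1)) =
      coeffX ((approximant f g A q (l + 1)).eval (HahnSeries.C c)) (-(l + 1))) :
    OrdLE (y - (approximant f g A q (l + 1)).eval (HahnSeries.C c)) (-((l + 1 : ℕ) + 1)) := by
  rw [show -(((l + 1 : ℕ) : ℤ) + 1) = -(l + 1) - 1 by push_cast; ring]
  refine .pred ?_ (by rw [coeffX_sub, hy, sub_self])
  rw [eval_approximant_succ, ← sub_sub]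
  exact h.sub (ordLE_single _ _)

theorem IsApproxSolution.ordLE_sub_approximant (hA : Nonresonant f A)
    (hq : IsApproxSolution f g A q) (hy : HasTopCoeff f A y)
    (hres : residual (ofPoly f) (ofPoly g) y = 0) (h : OrdLE (y - ofPoly q) 0)
    (hc : coeffX (y - ofPoly q) 0 = c) (l : ℕ) :
    OrdLE (y - (approximant f g A q l).eval (HahnSeries.C c)) (-(l + 1)) := by
  induction l with
  | zero => exact ordLE_sub_approximant_zero h hc
  | succ l ih =>
    have hlin := coeffX_residual_sub (g := g) hy (hq.hasTopCoeff_approximant c l) ih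
    rw [hres, zero_sub, coeffX_neg, coeffX_sub, ← sub_eq_add_neg] at hlin
    have hind := hA (-(l + 1)) (by lia)
    refine ordLE_sub_approximant_succ ih ?_
    rw [eval_approximant_succ, coeffX_add, coeffX_single, if_pos rfl]
    field_simp
    linear_combination -hlin

theorem IsApproxSolution.eq_eval_seriesCoeff (hA : Nonresonant f A) (hq : IsApproxSolution f g A q)
    {c : ℕ → ℂ} (hy : IsSolution f g (ofPoly q + tail c)) (l : ℕ) :
    c l = (seriesCoeff f g A q l).eval (c 0) := by
  have h := hq.ordLE_sub_approximant hA (hq.hasTopCoeff_add (ordLE_tail c)) hy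
    (by rw [add_sub_cancel_left]; exact ordLE_tail c)
    (by rw [add_sub_cancel_left, coeffX_tail_zero]) l (-l) (by lia)
  rw [coeffX_sub, hq.coeffX_add_tail, ← eval_seriesCoeff] at h
  exact sub_eq_zero.mp h

theorem IsApproxSolution.isSolution_add_tail (hA : Nonresonant f A) (hq : IsApproxSolution f g A q)
    (hc : coeffX (residual (ofPoly f) (ofPoly g) (ofPoly q)) f.natDegree + indicial f A 0 * c = 0) :
    IsSolution f g (ofPoly q + tail fun l => (seriesCoeff f g A q l).eval c) := by
  set y := ofPoly q + tail fun l => (seriesCoeff f g A q l).eval c with hy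
  have hcoeff (l : ℕ) : coeffX y (-l) =
      coeffX ((approximant f g A q l).eval (HahnSeries.C c)) (-l) := by
    rw [hy, hq.coeffX_add_tail, eval_seriesCoeff]
  have hsub (l : ℕ) : OrdLE (y - (approximant f g A q l).eval (HahnSeries.C c)) (-(l + 1)) := by
    induction l with
    | zero =>
      refine ordLE_sub_approximant_zero ?_ ?_
      · simpa [hy] using ordLE_tail _
      · have h := hcoeff 0
        rw [eval_approximant_zero] at h
        rw [Nat.cast_zero, neg_zero, coeffX_add _ (HahnSeries.C c), hq.coeffX_zero_eq, zero_add,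
          coeffX_C_zero] at h
        rwa [coeffX_sub, hq.coeffX_zero_eq, sub_zero]
    | succ l ih => exact ordLE_sub_approximant_succ ih (by exact_mod_cast hcoeff (l + 1))
  refine OrdLE.eq_zero (d := f.natDegree - 1) fun l => ?_
  have h := (ordLE_residual_sub (g := g) (hq.hasTopCoeff_add (ordLE_tail _))
    (hq.hasTopCoeff_approximant c l) (hsub l)).add (hq.ordLE_residual_approximant hA hc l)
  rw [sub_add_cancel] at h
  exact h.mono (by lia)

theorem IsApproxSolution.exists_eq_add_tail (hA : Nonresonant f A) (hq : IsApproxSolution f g A q)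
    (hy : HasTopCoeff f A y) (hsol : IsSolution f g y) : ∃ c, y = ofPoly q + tail c := by
  obtain ⟨c, hc⟩ := (hq.ordLE_sub_ofPoly hA hy
    (by rw [isSolution_iff_residual_eq_zero.mp hsol]; exact .zero _)).exists_eq_tail
  exact ⟨c, by rw [← hc, add_sub_cancel]⟩

theorem IsApproxSolution.exists_forall_eq_add_tail (hA : ∀ i, indicial f A i ≠ 0)
    (hq : IsApproxSolution f g A q) : ∃ b, IsSolution f g (ofPoly q + tail b) ∧
      ∀ y, IsSolution f g y → HasTopCoeff f A y → y = ofPoly q + tail b := by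
  have hres : Nonresonant f A := fun i _ => hA i
  set ρ := coeffX (residual (ofPoly f) (ofPoly g) (ofPoly q)) f.natDegree
  refine ⟨_, hq.isSolution_add_tail hres (c := -ρ / indicial f A 0) ?_, fun y hy htop => ?_⟩
  · rw [mul_div_cancel₀ _ (hA 0), add_neg_cancel]
  obtain ⟨c, rfl⟩ := hq.exists_eq_add_tail hres htop hy
  have hc := hq.coeffX_residual_add (ordLE_tail c)
  rw [isSolution_iff_residual_eq_zero.mp hy, coeffX_zero, coeffX_tail_zero] at hc
  have hc0 : c 0 = -ρ / indicial f A 0 := by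
    rw [eq_div_iff (hA 0)]
    linear_combination -hc
  rw [← hc0]
  exact congrArg (ofPoly q + tail ·) (_root_.funext (hq.eq_eval_seriesCoeff hres hy))

theorem HasLeadingTerm.hasTopCoeff_leadI
    (h : HasLeadingTerm y (leadI f) (f.natDegree + 1)) : HasTopCoeff f (leadI f) y :=
  ⟨h.2.2, h.2.1⟩

theorem HasLeadingTerm.hasTopCoeff_zero {a : ℂ} {d : ℤ} (h : HasLeadingTerm y a d)
    (hd : d ≤ f.natDegree) : HasTopCoeff f 0 y :=
  ⟨OrdLE.mono h.2.2 (by lia), h.2.2 _ (by lia)⟩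

end SeriesSolution

/-! ### Darboux polynomials over the field of series -/

section Factorization

theorem OrdLE.eval {G : (LaurentSeries ℂ)[X]} {w : LaurentSeries ℂ} {d : ℤ}
    (hG : ∀ j, OrdLE (G.coeff j) d) (hw : OrdLE w 0) : OrdLE (G.eval w) d := by
  rw [eval_eq_sum, Polynomial.sum_def]
  exact .sum fun j _ => by simpa only [add_zero] using (hG j).mul (hw.pow j)

theorem OrdLE.coeffX_eval {G : (LaurentSeries ℂ)[X]} {w : LaurentSeries ℂ} {d : ℤ}
    (hG : ∀ j, OrdLE (G.coeff j) d) (hw : OrdLE w 0) :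
    coeffX (G.eval w) d = (coeffPoly G d).eval (coeffX w 0) := by
  rw [eval_coeffPoly_eq_sum, eval_eq_sum, Polynomial.sum_def, coeffX_sum]
  refine Finset.sum_congr rfl fun j _ => ?_
  have h := (hG j).coeffX_mul (hw.pow j)
  rwa [add_zero, hw.coeffX_pow] at h

theorem exists_coeffPoly_ne_zero {G : (LaurentSeries ℂ)[X]} (hG : G ≠ 0) :
    ∃ d, (∀ j, OrdLE (G.coeff j) d) ∧ coeffPoly G d ≠ 0 := by
  obtain ⟨k, hk, hmin⟩ := G.support.exists_min_image (fun j => (G.coeff j).order)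
    (support_nonempty.mpr hG)
  refine ⟨-(G.coeff k).order, fun j i hi => ?_, fun h => ?_⟩
  · by_cases hj : j ∈ G.support
    · exact HahnSeries.coeff_eq_zero_of_lt_order (by have := hmin j hj; lia)
    · rw [notMem_support_iff.mp hj, coeffX_zero]
  · have hcoeff := congrArg (coeff · k) h
    rw [coeff_zero, coeff_coeffPoly, coeffX, neg_neg, HahnSeries.coeff_order_eq_zero] at hcoeff
    exact mem_support_iff.mp hk hcoeff

theorem coeffPoly_derivative (G : (LaurentSeries ℂ)[X]) (i : ℤ) :
    coeffPoly (derivative G) i = derivative (coeffPoly G i) := by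
  ext j
  rw [coeff_coeffPoly, coeff_derivative, coeff_derivative, coeff_coeffPoly, ← Nat.cast_succ,
    ← Nat.cast_succ, mul_comm, ← nsmul_eq_mul, mul_comm, ← nsmul_eq_mul, coeffX,
    HahnSeries.coeff_nsmul]
  rfl

theorem eq_zero_of_C_mul_eq_C_mul_derivative {H : ℂ[X]} (hH : H ≠ 0) {a b : ℂ}
    (h : C a * H = C b * derivative H) : a = 0 := by
  by_contra ha
  have hdeg := (degree_C_mul ha).symm.trans (congrArg degree h)
  rw [← smul_eq_C_mul] at hdeg
  exact (hdeg.trans_le (degree_smul_le b _)).not_gt (degree_derivative_lt hH)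

theorem derivative_taylor {R : Type*} [CommRing R] (r : R) (W : R[X]) :
    derivative (taylor r W) = taylor r (derivative W) := by
  rw [taylor_apply, taylor_apply, derivative_comp, derivative_add, derivative_X, derivative_C,
    add_zero, one_mul]

variable {f g q : ℂ[X]} {W : (LaurentSeries ℂ)[X]} {κ : LaurentSeries ℂ}

/-- For `G = W(q + ·)` of order `d` in `x`, this is the coefficient of `x ^ (deg f + d)` in the
Darboux equation at `y = q + c`, as an identity between polynomials in the constant `c`. -/
theorem IsApproxSolution.C_mul_coeffPoly_taylor (hq : IsApproxSolution f g (leadI f) q)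
    (hW : IsDarboux (ofPoly f) (ofPoly g) W κ) (hκ : OrdLE κ (f.natDegree - 1)) {d : ℤ}
    (hd : ∀ j, OrdLE ((taylor (ofPoly q) W).coeff j) d) :
    C (leadI f * d) * coeffPoly (taylor (ofPoly q) W) d =
      C (coeffX (residual (ofPoly f) (ofPoly g) (ofPoly q)) f.natDegree) *
        derivative (coeffPoly (taylor (ofPoly q) W) d) := by
  set G := taylor (ofPoly q) W with hG
  set ρ := coeffX (residual (ofPoly f) (ofPoly g) (ofPoly q)) f.natDegree
  have hd' (j : ℕ) : OrdLE ((derivative G).coeff j) d := by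
    rw [coeff_derivative, ← Nat.cast_succ, mul_comm]
    exact (hd (j + 1)).natCast_mul (j + 1)
  refine funext fun c => ?_
  set s := ofPoly q + HahnSeries.C c
  have htop : HasTopCoeff f (leadI f) s := hq.hasTopCoeff_add (ordLE_C c)
  have hWs : W.eval s = G.eval (HahnSeries.C c) := by rw [hG, taylor_eval, add_comm]
  have hW's : (derivative W).eval s = (derivative G).eval (HahnSeries.C c) := by
    rw [hG, derivative_taylor, taylor_eval, add_comm]
  have hGc : OrdLE (G.eval (HahnSeries.C c)) d := .eval hd (ordLE_C c)
  have hres : coeffX (residual (ofPoly f) (ofPoly g) s) f.natDegree = ρ := by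
    rw [hq.coeffX_residual_add (ordLE_C c), indicial_leadI, Int.cast_zero, zero_mul, zero_mul,
      add_zero]
  have hid := congrArg (eval s) hW
  rw [eval_vectorField, eval_mul, eval_C, hWs, hW's, sub_eq_iff_eq_add] at hid
  have hcoeff := congrArg (coeffX · (f.natDegree + d)) hid
  have h1 := htop.ordLE.coeffX_mul hGc.deriv
  rw [htop.coeffX_eq, deriv_eq_derivX, coeffX_derivX,
    show (f.natDegree : ℤ) + 1 + (d - 1) = f.natDegree + d by ring] at h1
  rw [deriv_eq_derivX, h1, coeffX_add, (hκ.mul hGc) _ (by lia),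
    (hq.ordLE_residual_add (ordLE_C c)).coeffX_mul (.eval hd' (ordLE_C c)), hres,
    ← eval_coeffPoly, ← eval_coeffPoly, coeffPoly_derivative] at hcoeff
  simp only [eval_mul, eval_C]
  linear_combination hcoeff

theorem IsApproxSolution.exists_coeffX_eval_eq_zero (hf : f ≠ 0)
    (hq : IsApproxSolution f g (leadI f) q) (hW : IsDarboux (ofPoly f) (ofPoly g) W κ)
    (hκ : OrdLE κ (f.natDegree - 1)) (hmonic : W.Monic) (hdeg : W.natDegree ≠ 0) :
    coeffX (residual (ofPoly f) (ofPoly g) (ofPoly q)) f.natDegree = 0 ∧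
      ∃ c : ℂ, ∀ w, OrdLE w 0 → coeffX w 0 = c → OrdLE (W.eval (ofPoly q + w)) (-1) := by
  obtain ⟨d, hd, hH0⟩ :=
    exists_coeffPoly_ne_zero ((taylor_eq_zero (ofPoly q) W).not.mpr hmonic.ne_zero)
  have hid := hq.C_mul_coeffPoly_taylor hW hκ hd
  obtain rfl : d = 0 := by
    simpa [leadI_ne_zero hf] using eq_zero_of_C_mul_eq_C_mul_derivative hH0 hid
  set H := coeffPoly (taylor (ofPoly q) W) 0 with hH
  have hHdeg : H.natDegree ≠ 0 := fun h => by
    have htop : H.coeff W.natDegree = 1 := by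
      rw [hH, coeff_coeffPoly, coeff_taylor_natDegree, hmonic, ← HahnSeries.C_one, coeffX_C_zero]
    rw [coeff_eq_zero_of_natDegree_lt (by lia)] at htop
    exact zero_ne_one htop
  refine ⟨by simpa [derivative_eq_zero, hHdeg] using hid.symm, ?_⟩
  obtain ⟨c, hc⟩ := IsAlgClosed.exists_root H fun h => hHdeg (natDegree_eq_of_degree_eq_some h)
  refine ⟨c, fun w hw hwc => ?_⟩
  rw [add_comm, ← taylor_eval]
  exact (OrdLE.eval hd hw).pred (by rwa [OrdLE.coeffX_eval hd hw, hwc])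

theorem IsDarboux.eval_eq_zero {y : LaurentSeries ℂ} (hf : f ≠ 0)
    (hW : IsDarboux (ofPoly f) (ofPoly g) W κ) (hκ : OrdLE κ (f.natDegree - 1))
    (hy : HasTopCoeff f (leadI f) y) (hsol : IsSolution f g y) (hWy : OrdLE (W.eval y) (-1)) :
    W.eval y = 0 := by
  by_contra hu
  obtain ⟨e, he, he0⟩ := exists_ordLE_coeffX_ne_zero hu
  have he' : e < 0 := by
    by_contra! h
    exact he0 (hWy e (by lia))
  have htop := hy.ordLE.coeffX_mul he.deriv
  rw [hW.mul_deriv_eval hsol, hκ.mul he _ (by lia), hy.coeffX_eq, deriv_eq_derivX, coeffX_derivX]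
    at htop
  exact mul_ne_zero (leadI_ne_zero hf) (mul_ne_zero (by exact_mod_cast he'.ne) he0) htop.symm

theorem IsApproxSolution.exists_isSolution_eval_eq_zero (hf : f ≠ 0)
    (hq : IsApproxSolution f g (leadI f) q) (hW : IsDarboux (ofPoly f) (ofPoly g) W κ)
    (hκ : OrdLE κ (f.natDegree - 1)) (hmonic : W.Monic) (hdeg : W.natDegree ≠ 0) :
    ∃ c, IsSolution f g (ofPoly q + tail c) ∧ W.eval (ofPoly q + tail c) = 0 := by
  obtain ⟨hρ, a, ha⟩ := hq.exists_coeffX_eval_eq_zero hf hW hκ hmonic hdeg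
  have hsol := hq.isSolution_add_tail (nonresonant_leadI hf) (c := a)
    (by rw [hρ, indicial_leadI, Int.cast_zero, zero_mul, zero_mul, add_zero])
  have h0 : (seriesCoeff f g (leadI f) q 0).eval a = a := by
    rw [eval_seriesCoeff, eval_approximant_zero, Nat.cast_zero, neg_zero, coeffX_add,
      hq.coeffX_zero_eq, zero_add, coeffX_C_zero]
  exact ⟨_, hsol, hW.eval_eq_zero hf hκ (hq.hasTopCoeff_add (ordLE_tail _)) hsol
    (ha _ (ordLE_tail _) ((coeffX_tail_zero _).trans h0))⟩

theorem IsApproxSolution.exists_eq_prod (hf : f ≠ 0) (hq : IsApproxSolution f g (leadI f) q)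
    (hW : IsDarboux (ofPoly f) (ofPoly g) W κ) (hκ : OrdLE κ (f.natDegree - 1))
    (hmonic : W.Monic) : ∃ (n : ℕ) (c : Fin n → ℕ → ℂ),
      (∀ j, IsSolution f g (ofPoly q + tail (c j))) ∧
      W = ∏ j, (X - C (ofPoly q + tail (c j))) ∧
      κ = -∑ j, (ofPoly f + (ofPoly q + tail (c j))′) := by
  induction hn : W.natDegree generalizing W κ with
  | zero =>
    obtain rfl := hmonic.natDegree_eq_zero.mp hn
    exact ⟨0, Fin.elim0, fun j => j.elim0, by simp, by simpa using hW.cofactor_one⟩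
  | succ n ih =>
    obtain ⟨c₀, hsol, hroot⟩ :=
      hq.exists_isSolution_eval_eq_zero hf hW hκ hmonic (by lia)
    set y := ofPoly q + tail c₀ with hy
    obtain ⟨V, rfl⟩ := dvd_iff_isRoot.mpr hroot
    rw [mul_comm] at hW
    have htop : HasTopCoeff f (leadI f) y := hq.hasTopCoeff_add (ordLE_tail c₀)
    have hcof : OrdLE (ofPoly f + y′) (f.natDegree - 1) := by
      rw [add_comm]
      exact htop.ordLE_deriv_add.pred
        (by rw [htop.coeffX_deriv_add, indicial_leadI, Int.cast_zero, zero_mul])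
    have hVW := hW.of_mul (X_sub_C_ne_zero y) (.X_sub_C hsol)
    rw [sub_neg_eq_add] at hVW
    have hVmonic := (monic_X_sub_C y).of_mul_monic_left hmonic
    rw [(monic_X_sub_C y).natDegree_mul hVmonic, natDegree_X_sub_C, add_comm] at hn
    obtain ⟨n', c, hc, hV, hκV⟩ := ih hVW (hκ.add hcof) hVmonic (Nat.succ_injective hn)
    refine ⟨n' + 1, Fin.cons c₀ c, Fin.cases hsol hc, ?_, ?_⟩
    · rw [Fin.prod_univ_succ, hV]
      rfl
    · rw [Fin.sum_univ_succ, eq_sub_of_add_eq hκV]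
      simp only [Fin.cons_zero, Fin.cons_succ, ← hy]
      ring

theorem ordLE_of_mul_deriv_eq {z v : LaurentSeries ℂ} {d : ℤ} (hz : OrdLE z d) (hv : v ≠ 0)
    (h : z * v′ = κ * v) : OrdLE κ (d - 1) := by
  obtain ⟨e, he, he0⟩ := exists_ordLE_coeffX_ne_zero hv
  refine ordLE_of_ordLE_mul he he0 ?_
  rw [← h]
  exact (hz.mul he.deriv).mono (by lia)

theorem IsApproxSolution.exists_eq_prod_mul_pow (hf : f ≠ 0) {z : LaurentSeries ℂ}
    (hq : IsApproxSolution f g (leadI f) q) (hz : IsSolution f g z) (hztop : HasTopCoeff f 0 z)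
    (hW : IsDarboux (ofPoly f) (ofPoly g) W κ) (hmonic : W.Monic) :
    ∃ (n k : ℕ) (c : Fin n → ℕ → ℂ),
      (∀ j, IsSolution f g (ofPoly q + tail (c j))) ∧
      W = (∏ j, (X - C (ofPoly q + tail (c j)))) * (X - C z) ^ k ∧
      κ = -∑ j, (ofPoly f + (ofPoly q + tail (c j))′) - k * (ofPoly f + z′) := by
  obtain ⟨V, k, rfl, hVz, hV⟩ := hW.exists_eq_mul_pow hmonic.ne_zero hz
  have hzm : OrdLE z f.natDegree := by simpa using hztop.ordLE.pred hztop.coeffX_eq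
  obtain ⟨n, c, hc, rfl, hκ⟩ := hq.exists_eq_prod hf hV
    (ordLE_of_mul_deriv_eq hzm hVz (hV.mul_deriv_eval hz))
    (((monic_X_sub_C z).pow k).of_mul_monic_right hmonic)
  exact ⟨n, k, c, hc, rfl, eq_sub_of_add_eq hκ⟩

end Factorization

/-! ### Invariant algebraic curves -/

section InvariantCurve

theorem squarefree_map_fractionRing {R : Type*} [CommRing R] [IsDomain R] [IsIntegrallyClosed R]
    {G : R[X]} (hG : G.Monic) (hsq : Squarefree G) :
    Squarefree (G.map (algebraMap R (FractionRing R))) := by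
  intro h hdvd
  have hinj := IsFractionRing.injective R (FractionRing R)
  have hlc : h.leadingCoeff ≠ 0 := by
    refine leadingCoeff_ne_zero.mpr ?_
    rintro rfl
    exact (hG.map _).ne_zero (zero_dvd_iff.mp (by rwa [mul_zero] at hdvd))
  obtain ⟨u, hu⟩ := IsIntegrallyClosed.eq_map_mul_C_of_dvd (FractionRing R) hG
    ((dvd_mul_right h h).trans hdvd)
  have hmonic : u.Monic := monic_of_injective hinj <| by
    have hlead := congrArg leadingCoeff hu
    rw [leadingCoeff_mul, leadingCoeff_C] at hlead
    exact (mul_eq_right₀ hlc).mp hlead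
  have hdvd_h : u.map (algebraMap R (FractionRing R)) ∣ h := Dvd.intro _ hu
  have hdvd_G : u * u ∣ G := by
    rw [← map_dvd_map _ hinj (hmonic.mul hmonic), Polynomial.map_mul]
    exact (mul_dvd_mul hdvd_h hdvd_h).trans hdvd
  rw [← hu]
  exact ((hsq u hdvd_G).map (mapRingHom _)).mul (isUnit_C.mpr hlc.isUnit)

theorem separable_map_of_squarefree {R K : Type*} [CommRing R] [IsDomain R] [IsIntegrallyClosed R]
    [CharZero R] [Field K] {φ : R →+* K} (hφ : Function.Injective φ) {G : R[X]} (hG : G.Monic)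
    (hsq : Squarefree G) : (G.map φ).Separable := by
  have : CharZero (FractionRing R) :=
    charZero_of_injective_algebraMap (IsFractionRing.injective R (FractionRing R))
  have hsep : (G.map (algebraMap R (FractionRing R))).Separable :=
    PerfectField.separable_iff_squarefree.mpr (squarefree_map_fractionRing hG hsq)
  have hcomp : (IsFractionRing.lift (K := FractionRing R) hφ).comp
      (algebraMap R (FractionRing R)) = φ :=
    RingHom.ext fun p => IsFractionRing.lift_algebraMap hφ p
  rw [← hcomp, ← Polynomial.map_map]
  exact hsep.map

theorem natDegree_eq_zero_of_derivative_eq_mul {R : Type*} [CommRing R] [IsDomain R] [CharZero R]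
    {a b : R[X]} (h : derivative a = b * a) : a.natDegree = 0 := by
  by_contra h0
  have ha : a ≠ 0 := ne_zero_of_natDegree_gt (Nat.pos_of_ne_zero h0)
  have hdvd : a ∣ derivative a := h ▸ dvd_mul_left a b
  exact h0 (derivative_eq_zero.mp (eq_zero_of_dvd_of_degree_lt hdvd (degree_derivative_lt ha)))

theorem natDegree_partialX_le (F : ℂ[X][Y]) : (partialX F).natDegree ≤ F.natDegree :=
  natDegree_le_iff_coeff_eq_zero.mpr fun i hi => by
    rw [coeff_partialX, coeff_eq_zero_of_natDegree_lt hi, derivative_zero]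

theorem natDegree_neg_C_mul_X_sub_C_le (f g : ℂ[X]) :
    (-(C f * Y) - C g : ℂ[X][Y]).natDegree ≤ 1 := by
  compute_degree

variable {f g : ℂ[X]} {F L : ℂ[X][Y]}

theorem IsLienardInvariantCurve.ne_zero (h : IsLienardInvariantCurve f g F L) : F ≠ 0 :=
  fun h0 => h.1 0 (by rw [h0, C_0, C_0])

theorem IsLienardInvariantCurve.natDegree_cofactor_le (h : IsLienardInvariantCurve f g F L) :
    L.natDegree ≤ 1 := by
  rcases eq_or_ne L 0 with rfl | hL
  · simp
  have hLF : (L * F).natDegree ≤ 1 + F.natDegree := by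
    rw [← h.2]
    exact natDegree_add_le_of_degree_le
      (natDegree_mul_le_of_le natDegree_X_le (natDegree_partialX_le F))
      (natDegree_mul_le_of_le (natDegree_neg_C_mul_X_sub_C_le f g)
        ((natDegree_derivative_le F).trans (Nat.sub_le _ _)))
  rw [natDegree_mul hL h.ne_zero] at hLF
  lia

theorem IsLienardInvariantCurve.derivative_leadingCoeff (h : IsLienardInvariantCurve f g F L) :
    derivative F.leadingCoeff = L.coeff 1 * F.leadingCoeff := by
  have hder : (derivative F).natDegree ≤ F.natDegree :=
    (natDegree_derivative_le F).trans (Nat.sub_le _ _)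
  have hdertop : (derivative F).coeff F.natDegree = 0 := by
    rw [coeff_derivative, coeff_eq_zero_of_natDegree_lt (Nat.lt_succ_self _), zero_mul]
  have htop := coeff_mul_add_eq_of_natDegree_le h.natDegree_cofactor_le (le_refl F.natDegree)
  rwa [← h.2, coeff_add,
    coeff_mul_add_eq_of_natDegree_le (natDegree_neg_C_mul_X_sub_C_le f g) hder, hdertop,
    mul_zero, add_zero, coeff_mul_add_eq_of_natDegree_le natDegree_X_le (natDegree_partialX_le F),
    coeff_partialX, coeff_X_one, one_mul] at htop

theorem IsLienardInvariantCurve.exists_monic (h : IsLienardInvariantCurve f g F L) :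
    ∃ (μ : ℂ) (G : ℂ[X][Y]) (ev : ℂ[X]), μ ≠ 0 ∧ G.Monic ∧ G.natDegree ≠ 0 ∧
      F = C (C μ) * G ∧ L = C ev := by
  obtain ⟨μ, hμ⟩ := natDegree_eq_zero.mp
    (natDegree_eq_zero_of_derivative_eq_mul h.derivative_leadingCoeff)
  have hlc := leadingCoeff_ne_zero.mpr h.ne_zero
  have hμ0 : μ ≠ 0 := by
    rintro rfl
    exact hlc (hμ.symm.trans C_0)
  have hF : F = C (C μ) * (C (C μ⁻¹) * F) := by
    rw [← mul_assoc, ← C_mul, ← C_mul, mul_inv_cancel₀ hμ0, C_1, C_1, one_mul]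
  have hmonic : (C (C μ⁻¹) * F).Monic := monic_C_mul_of_mul_leadingCoeff_eq_one
    (by rw [← hμ, ← C_mul, inv_mul_cancel₀ hμ0, C_1])
  have hL : L.coeff 1 = 0 := by
    have htop := h.derivative_leadingCoeff
    rw [← hμ, derivative_C, hμ] at htop
    exact (mul_eq_zero.mp htop.symm).resolve_right hlc
  refine ⟨μ, _, L.coeff 0, hμ0, hmonic, fun hdeg => h.1 μ ?_, hF, ?_⟩
  · rw [hF, hmonic.natDegree_eq_zero.mp hdeg, mul_one]
  · rw [eq_X_add_C_of_natDegree_le_one h.natDegree_cofactor_le, hL]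
    simp

theorem vectorField_map {K : Type*} [CommRing K] [Differential K] {ψ : ℂ[X] →+* K}
    (hψ : ∀ r, (ψ r)′ = ψ (derivative r)) (f g : ℂ[X]) (F : ℂ[X][Y]) :
    vectorField (ψ f) (ψ g) (F.map ψ) =
      (Y * partialX F + (-(C f * Y) - C g) * derivative F).map ψ := by
  have hpart : Differential.mapCoeffs (F.map ψ) = (partialX F).map ψ := by
    ext i
    rw [Differential.coeff_mapCoeffs, coeff_map, coeff_map, coeff_partialX, hψ]
  rw [vectorField_apply, hpart, derivative_map]
  simp only [Polynomial.map_add, Polynomial.map_mul, Polynomial.map_sub, Polynomial.map_neg,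
    map_X, map_C]
  ring

theorem polyPart_map (F : ℂ[X][Y]) : polyPart (F.map ofPoly) = F := by
  ext j i
  rw [coeff_polyPart, coeff_map, coeffX_ofPoly]

theorem IsLienardInvariantCurve.isDarboux {ev : ℂ[X]} (h : IsLienardInvariantCurve f g F (C ev)) :
    IsDarboux (ofPoly f) (ofPoly g) (F.map ofPoly) (ofPoly ev) := by
  rw [IsDarboux, vectorField_map deriv_ofPoly, h.2, Polynomial.map_mul, map_C]

theorem IsLienardInvariantCurve.isDarboux_of_const_mul {μ : ℂ} {G : ℂ[X][Y]} {ev : ℂ[X]}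
    (hμ : μ ≠ 0) (h : IsLienardInvariantCurve f g (C (C μ) * G) (C ev)) :
    IsDarboux (ofPoly f) (ofPoly g) (G.map ofPoly) (ofPoly ev) := by
  refine IsDarboux.of_const_mul (c := ofPoly (C μ)) ?_ ?_ ?_
  · rw [Ne, map_eq_zero_iff _ ofPoly_injective]
    exact C_ne_zero.mpr hμ
  · rw [deriv_ofPoly, derivative_C, map_zero]
  · rw [← map_C, ← Polynomial.map_mul]
    exact h.isDarboux

theorem eq_of_ofPoly_eq_cofactor {f q p ev : ℂ[X]} {N k : ℕ} (hk : k ≤ N)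
    {c : Fin (N - k) → ℕ → ℂ} {b : ℕ → ℂ}
    (h : ofPoly ev = -∑ j, (ofPoly f + (ofPoly q + tail (c j))′) -
      k * (ofPoly f + (ofPoly p + tail b)′)) :
    ev = -((N : ℂ[X]) * f) - ((N : ℂ[X]) - (k : ℂ[X])) * derivative q
      - (k : ℂ[X]) * derivative p := by
  have htail (e : ℕ → ℂ) : OrdLE (tail e)′ (-1) := (ordLE_tail e).deriv
  rw [← sub_eq_zero]
  refine eq_zero_of_ordLE_ofPoly_neg_one ?_
  have hrest : ofPoly (ev - (-((N : ℂ[X]) * f) - ((N : ℂ[X]) - (k : ℂ[X])) * derivative q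
      - (k : ℂ[X]) * derivative p)) = 0 - ∑ j, (tail (c j))′ - k * (tail b)′ := by
    simp only [map_sub, map_neg, map_mul, map_natCast, h, deriv_ofPoly, map_add,
      Finset.sum_add_distrib, Finset.sum_const, Finset.card_univ, Fintype.card_fin, nsmul_eq_mul,
      Nat.cast_sub hk]
    ring
  rw [hrest]
  exact ((OrdLE.zero _).sub (OrdLE.sum fun j _ => htail (c j))).sub ((htail b).natCast_mul k)

theorem injective_of_separable_prod_mul_pow {ι K : Type*} [Fintype ι] [Field K] {r : ι → K} {z : K}
    {k : ℕ} (h : ((∏ j, (X - C (r j))) * (X - C z) ^ k).Separable) :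
    k ≤ 1 ∧ Function.Injective r := by
  refine ⟨?_, h.of_mul_left.injective_of_prod_X_sub_C⟩
  rcases h.of_mul_right.of_pow' with hunit | hk | hk
  · exact absurd hunit (not_isUnit_X_sub_C z)
  · exact hk.2.le
  · exact hk.le.trans zero_le_one

theorem IsApproxSolution.coeff_zero_injective {A : ℂ} {q : ℂ[X]} {ι : Type*} {c : ι → ℕ → ℂ}
    (hA : Nonresonant f A) (hq : IsApproxSolution f g A q)
    (hc : ∀ j, IsSolution f g (ofPoly q + tail (c j)))
    (hinj : Function.Injective fun j => ofPoly q + tail (c j)) :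
    Function.Injective fun j => c j 0 := by
  intro i j hij
  refine hinj (congrArg (fun e => ofPoly q + tail e) (funext fun l => ?_))
  rw [hq.eq_eval_seriesCoeff hA (hc i), hq.eq_eval_seriesCoeff hA (hc j)]
  exact congrArg (eval · _) hij

theorem IsLienardInvariantCurve.exists_eq_polyPart {q p : ℂ[X]} {b : ℕ → ℂ} (hf : f ≠ 0)
    (hq : IsApproxSolution f g (leadI f) q) (hp : IsApproxSolution f g 0 p)
    (hb : IsSolution f g (ofPoly p + tail b)) (h : IsLienardInvariantCurve f g F L) :
    ∃ (N k : ℕ) (c : Fin (N - k) → ℕ → ℂ) (μ : ℂ), 1 ≤ N ∧ k ≤ N ∧ μ ≠ 0 ∧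
      (∀ j, IsSolution f g (ofPoly q + tail (c j))) ∧
      F = C (C μ) * polyPart
        ((∏ j, (X - C (ofPoly q + tail (c j)))) * (X - C (ofPoly p + tail b)) ^ k) ∧
      L = C (-((N : ℂ[X]) * f) - ((N : ℂ[X]) - (k : ℂ[X])) * derivative q
        - (k : ℂ[X]) * derivative p) ∧
      (Squarefree F → k ≤ 1 ∧ ∀ i j, i ≠ j → c i 0 ≠ c j 0) := by
  obtain ⟨μ, G, ev, hμ, hG, hdeg, rfl, rfl⟩ := h.exists_monic
  obtain ⟨n, k, c, hc, hfac, hev⟩ := hq.exists_eq_prod_mul_pow hf hb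
    (hp.hasTopCoeff_add (ordLE_tail b)) (h.isDarboux_of_const_mul hμ) (hG.map ofPoly)
  obtain ⟨N, hkN, rfl⟩ : ∃ N, k ≤ N ∧ n = N - k := ⟨n + k, by lia, by lia⟩
  refine ⟨N, k, c, μ, ?_, hkN, hμ, hc, ?_, congrArg C (eq_of_ofPoly_eq_cofactor hkN hev), ?_⟩
  · by_contra! hN
    obtain ⟨rfl, rfl⟩ : N = 0 ∧ k = 0 := by lia
    refine hdeg ?_
    rw [← hG.natDegree_map ofPoly, hfac]
    simp
  · rw [← hfac, polyPart_map]
  · intro hsq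
    obtain ⟨hk, hinj⟩ := injective_of_separable_prod_mul_pow
      (hfac ▸ separable_map_of_squarefree ofPoly_injective hG
        (hsq.squarefree_of_dvd (dvd_mul_left _ _)))
    exact ⟨hk, fun i j => (hq.coeff_zero_injective (nonresonant_leadI hf) hc hinj).ne⟩

end InvariantCurve

end Lienard

end
open Lienard in
theorem theorem5_general (f g : ℂ[X]) (hfg : f.natDegree < g.natDegree)
    (hgf : g.natDegree < 2 * f.natDegree + 1) :
    ∃ (q p : ℂ[X]) (b : ℕ → ℂ) (Φ : ℕ → ℂ[X]),
      IsPrincipalPart f g (leadI f) (f.natDegree + 1) q ∧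
      (∀ r : ℂ[X], IsPrincipalPart f g (leadI f) (f.natDegree + 1) r → r = q) ∧
      IsPrincipalPart f g (leadII f g) (g.natDegree - f.natDegree) p ∧
      (∀ r : ℂ[X], IsPrincipalPart f g (leadII f g) (g.natDegree - f.natDegree) r → r = p) ∧
      (∀ y : LaurentSeries ℂ, IsSolution f g y →
        HasLeadingTerm y (leadI f) ((f.natDegree : ℤ) + 1) →
        ∃ c : ℕ → ℂ, y = ofPoly q + tail c ∧ ∀ l, 1 ≤ l → c l = (Φ l).eval (c 0)) ∧
      IsSolution f g (ofPoly p + tail b) ∧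
      (∀ y : LaurentSeries ℂ, IsSolution f g y →
        HasLeadingTerm y (leadII f g) ((g.natDegree : ℤ) - f.natDegree) →
        y = ofPoly p + tail b) ∧
      (∀ F L : ℂ[X][Y], IsLienardInvariantCurve f g F L →
        ∃ (N k : ℕ) (c : Fin (N - k) → ℕ → ℂ) (μ : ℂ), 1 ≤ N ∧ k ≤ N ∧ μ ≠ 0 ∧
          (∀ j, IsSolution f g (ofPoly q + tail (c j))) ∧
          (∀ j l, 1 ≤ l → c j l = (Φ l).eval (c j 0)) ∧
          F = C (C μ) * polyPart
            ((∏ j, (X - C (ofPoly q + tail (c j)))) * (X - C (ofPoly p + tail b)) ^ k) ∧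
          L = C (-((N : ℂ[X]) * f) - ((N : ℂ[X]) - (k : ℂ[X])) * derivative q
            - (k : ℂ[X]) * derivative p) ∧
          (Squarefree F → k ≤ 1 ∧ ∀ i j, i ≠ j → c i 0 ≠ c j 0)) := by
  have hf : f ≠ 0 := by
    rintro rfl
    rw [natDegree_zero] at hfg hgf
    lia
  obtain ⟨q, hq⟩ := exists_isPrincipalPart_leadI hf hgf
  obtain ⟨p, hp⟩ := exists_isPrincipalPart_leadII hf hfg hgf
  have happrox := hq.isApproxSolution_leadI
  have happrox₂ := hp.isApproxSolution_zero (by lia)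
  have hresI := nonresonant_leadI hf
  obtain ⟨b, hb, hbuniq⟩ := happrox₂.exists_forall_eq_add_tail fun i => by
    rw [indicial_zero]
    exact leadingCoeff_ne_zero.mpr hf
  refine ⟨q, p, b, seriesCoeff f g (leadI f) q, hq,
    fun r hr => hr.isApproxSolution_leadI.eq hresI happrox, hp,
    fun r hr => (hr.isApproxSolution_zero (by lia)).eq (nonresonant_zero hf) happrox₂,
    fun y hy hlead => ?_, hb, fun y hy hlead => hbuniq y hy (hlead.hasTopCoeff_zero (by lia)),
    fun F L hFL => ?_⟩
  · obtain ⟨c, rfl⟩ := happrox.exists_eq_add_tail hresI hlead.hasTopCoeff_leadI hy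
    exact ⟨c, rfl, fun l _ => happrox.eq_eval_seriesCoeff hresI hy l⟩
  · obtain ⟨N, k, c, μ, hN, hkN, hμ, hc, hF, hL, hsq⟩ :=
      hFL.exists_eq_polyPart hf happrox happrox₂ hb
    exact ⟨N, k, c, μ, hN, hkN, hμ, hc,
      fun j l _ => happrox.eq_eval_seriesCoeff hresI (hc j) l, hF, hL, hsq⟩

open Lienard in
theorem theorem5 (f g : ℂ[X]) (hfg : f.natDegree < g.natDegree)
    (hgf : g.natDegree < 2 * f.natDegree + 1) :
    -- `q`, `p`, the coefficients `b` of the series (II), and the expressions `Φ` of the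
    -- coefficients of the series (I) through the free one depend only on `f` and `g`
    ∃ (q p : ℂ[X]) (b : ℕ → ℂ) (Φ : ℕ → ℂ[X]),
      -- `q` has the stated form and is uniquely determined
      IsPrincipalPart f g (leadI f) (f.natDegree + 1) q ∧
      (∀ r : ℂ[X], IsPrincipalPart f g (leadI f) (f.natDegree + 1) r → r = q) ∧
      -- `p` has the stated form and is uniquely determined
      IsPrincipalPart f g (leadII f g) (g.natDegree - f.natDegree) p ∧
      (∀ r : ℂ[X], IsPrincipalPart f g (leadII f g) (g.natDegree - f.natDegree) r → r = p) ∧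
      -- every series of type (I) has polynomial part `q` up to the free constant term, which
      -- determines all the other coefficients
      (∀ y : LaurentSeries ℂ, IsSolution f g y →
        HasLeadingTerm y (leadI f) ((f.natDegree : ℤ) + 1) →
        ∃ c : ℕ → ℂ, y = ofPoly q + tail c ∧ ∀ l, 1 ≤ l → c l = (Φ l).eval (c 0)) ∧
      -- the series of type (II) exists and is uniquely determined
      IsSolution f g (ofPoly p + tail b) ∧
      (∀ y : LaurentSeries ℂ, IsSolution f g y →
        HasLeadingTerm y (leadII f g) ((g.natDegree : ℤ) - f.natDegree) →
        y = ofPoly p + tail b) ∧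
      -- the structure of irreducible invariant algebraic curves and of their cofactors
      (∀ F L : ℂ[X][Y], Irreducible F → IsLienardInvariantCurve f g F L →
        ∃ (N k : ℕ) (c : Fin (N - k) → ℕ → ℂ) (μ : ℂ),
          1 ≤ N ∧ (k = 0 ∨ k = 1) ∧ μ ≠ 0 ∧
          (∀ j, IsSolution f g (ofPoly q + tail (c j))) ∧
          (∀ i j, i ≠ j → c i 0 ≠ c j 0) ∧
          (∀ j l, 1 ≤ l → c j l = (Φ l).eval (c j 0)) ∧
          F = C (C μ) * polyPart
            ((∏ j, (X - C (ofPoly q + tail (c j)))) * (X - C (ofPoly p + tail b)) ^ k) ∧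
          L = C (-((N : ℂ[X]) * f) - ((N : ℂ[X]) - (k : ℂ[X])) * derivative q
            - (k : ℂ[X]) * derivative p)) := by
  obtain ⟨q, p, b, Φ, hq, hqu, hp, hpu, hI, hb, hbu, hcurve⟩ := theorem5_general f g hfg hgf
  refine ⟨q, p, b, Φ, hq, hqu, hp, hpu, hI, hb, hbu, fun F L hirr hFL => ?_⟩
  obtain ⟨N, k, c, μ, hN, -, hμ, hc, hΦ, hF, hL, hsq⟩ := hcurve F L hFL
  obtain ⟨hk, hdist⟩ := hsq hirr.squarefree
  exact ⟨N, k, c, μ, hN, Nat.le_one_iff_eq_zero_or_eq_one.mp hk, hμ, hc, hdist, hΦ, hF, hL⟩
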